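/- **Setting.** Let $\Omega$ be a compact topological space with its Borel $\sigma$-algebra $\Sigma$ and a probability measure $m$ on $\Sigma$. A *graphop* is a bounded linear operator $A:L^\infty(\Omega,m)\to L^1(\Omega,m)$ that is positivity preserving ($v\ge 0$ $m$-a.e. implies $Av\ge 0$ $m$-a.e.) and self-adjoint ($\int (Av)\,w\,dm=\int v\,(Aw)\,dm$ for $v,w\in L^\infty(\Omega,m)$). A family of *fiber measures* of $A$ is a measurable family $(\nu_x)_{x\in\Omega}$ of finite measures on $\Omega$ such that for each $f\in L^\infty(\Omega,m)$ one has $(Af)(x)=\int_\Omega f(y)\,d\nu_x(y)$ for $m$-a.e. $x$. Fix such a family and put $\gamma_A:=\sup_{x\in\Omega}\nu_x(\Omega)$. The action of $A$ on functions is understood through this family, $(Ag)(x)=\int_\Omega g\,d\nu_x$. Let $\mathbb T=\mathbb R/2\pi\mathbb Z$, $T>0$, $C>0$, and let $D:\mathbb T\to\mathbb R$ satisfy $|D(u)-D(v)|\le |u-v|$ (distance on the circle) and $|D|\le 1$. Consider the initial value problem $$\partial_t\rho(t,u,x)=-\partial_u\big(\rho\,V\big)(t,u,x),\qquad \rho(0,u,x)=\rho^0(u,x),\qquad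 (t,u,x)\in[0,T]\times\mathbb T\times\Omega,$$ $$V(t,u,x)=V[A]\rho(t,u,x)=C\int_{\mathbb T}(A\rho)(t,v,x)\,D(v-u)\,dv,\qquad (A\rho)(t,v,x)=\int_\Omega\rho(t,v,y)\,d\nu_x(y).$$ A *weak solution* is a measurable $\rho:[0,T]\times\mathbb T\times\Omega\to\mathbb R$ such that for $m$-a.e. $x$: $\rho(t,\cdot,x)\in L^1(\mathbb T)$ for all $t\in[0,T]$ and $\int_0^T\!\int_{\mathbb T}\!\int_\Omega|\rho(t,u,y)|\,d\nu_x(y)\,du\,dt<\infty$ (so that the integrals below exist); $t\mapsto\int_{\mathbb T}\rho(t,u,x)f(u)\,du$ is continuous on $[0,T]$ for every $f\in C(\mathbb T)$; and for every $w\in C^1([0,T]\times\mathbb T)$ with support in $[0,T)\times\mathbb T$, $$\int_0^T\!\!\int_{\mathbb T}\rho(t,u,x)\big(\partial_tw(t,u)+V(t,u,x)\,\partial_uw(t,u)\big)\,du\,dt+\int_{\mathbb T}w(0,u)\,\rho^0(u,x)\,du=0 .$$ **Theorem.** Let $A$ be a graphop with fiber measures $(\nu_x)_{x\in\Omega}$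 such that $\gamma_A\le 1$. Let $b>0$ and let $(\mu_0^x)_{x\in\Omega}$ be a measurable family of finite Borel measures on $\mathbb T$ with $\sup_x\mu_0^x(\mathbb T)\le b$ that is absolutely continuous with a (jointly measurable, nonnegative) density $\rho^0$, i.e. $d\mu_0^x(u)=\rho^0(u,x)\,du$ for all $x\in\Omega$. Then the initial value problem has a weak solution $\rho$, and it is unique: if $\sigma$ is another weak solution, then for $m$-a.e. $x\in\Omega$ and every $t\in[0,T]$ one has $\sigma(t,u,x)=\rho(t,u,x)$ for a.e. $u\in\mathbb T$. -/

import Mathlib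

open MeasureTheory ProbabilityTheory
open scoped ENNReal

noncomputable section

namespace GraphopVFPE

instance fact_two_pi_pos : Fact ((0 : ℝ) < 2 * Real.pi) := ⟨Real.two_pi_pos⟩

/-- The circle `𝕋 = ℝ / 2πℤ`, with its geodesic distance and Lebesgue measure of total mass `2π`. -/
abbrev Torus : Type := AddCircle (2 * Real.pi)

/-- The derivative of a function on the circle. -/
def torusDeriv (f : Torus → ℝ) (u : Torus) : ℝ :=
  deriv (fun s : ℝ => f (u + (s : Torus))) 0

/-- Lebesgue measure on the time interval `[0, T]`. -/
def timeMeasure (T : ℝ) : Measure (Set.Icc (0 : ℝ) T) :=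
  (volume : Measure ℝ).comap Subtype.val

section Graphop

variable {Ω : Type*} [MeasurableSpace Ω] {m : Measure Ω}

/-- A graphop on `(Ω, m)`: a bounded linear operator `L^∞(Ω, m) → L^1(Ω, m)` (a P-operator) that is
positivity preserving and self-adjoint for `⟨v, w⟩ = ∫ v w dm`. -/
structure IsGraphop (A : Lp ℝ ∞ m →L[ℝ] Lp ℝ 1 m) : Prop where
  pos : ∀ v : Lp ℝ ∞ m, (∀ᵐ x ∂m, 0 ≤ v x) → ∀ᵐ x ∂m, 0 ≤ A v x
  selfAdjoint : ∀ v w : Lp ℝ ∞ m, ∫ x, A v x * w x ∂m = ∫ x, v x * A w x ∂m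

/-- `ν` is a (measurable) family of fiber measures `ν_x` of the operator `A`: finite measures with
`(A f)(x) = ∫ f(y) dν_x(y)` for `m`-a.e. `x`, for each `f ∈ L^∞(Ω, m)`. The identity is required for
every function in the class of `f`. -/
structure IsFiberFamily (A : Lp ℝ ∞ m →L[ℝ] Lp ℝ 1 m) (ν : Kernel Ω Ω) : Prop where
  finite : ∀ x, ν x Set.univ < ∞
  repr : ∀ (f : Ω → ℝ) (hf : MemLp f ∞ m), ∀ᵐ x ∂m, A (hf.toLp f) x = ∫ y, f y ∂(ν x)

/-- `γ = sup_x ν_x(Ω)`. -/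
def fiberSup (ν : Kernel Ω Ω) : ℝ≥0∞ := ⨆ x, ν x Set.univ

/-- The space of measurable families `(μ^x)` of finite Borel measures on the circle with
`sup_x μ^x(𝕋) ≤ b`. -/
def MBar (Ω : Type*) [MeasurableSpace Ω] (b : ℝ) : Set (Ω → Measure Torus) :=
  {μ | Measurable μ ∧ ⨆ x, μ x Set.univ ≤ ENNReal.ofReal b}

/-- The family `μ` is absolutely continuous with density `ρ`, i.e. `dμ^x(u) = ρ(u, x) du` for
all `x`. -/
structure HasDensity (μ : Ω → Measure Torus) (ρ : Torus → Ω → ℝ) : Prop where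
  measurable : Measurable (fun p : Torus × Ω => ρ p.1 p.2)
  nonneg : ∀ x, ∀ᵐ u : Torus, 0 ≤ ρ u x
  eq : ∀ x, μ x = volume.withDensity (fun u => ENNReal.ofReal (ρ u x))

/-- The action of the graphop on the node variable, `(A g)(x) = ∫ g(y) dν_x(y)`. -/
def graphopApply (ν : Kernel Ω Ω) (g : Ω → ℝ) (x : Ω) : ℝ := ∫ y, g y ∂(ν x)

/-- The characteristic field `V(t,u,x) = C ∫_𝕋 (A ρ)(t,v,x) D(v - u) dv`. -/
def charField (ν : Kernel Ω Ω) (C : ℝ) (D : Torus → ℝ) {T : ℝ}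
    (ρ : Set.Icc (0 : ℝ) T → Torus → Ω → ℝ) (t : Set.Icc (0 : ℝ) T) (u : Torus) (x : Ω) : ℝ :=
  C * ∫ v : Torus, graphopApply ν (ρ t v) x * D (v - u)

/-- Test functions: `C^1` in `(t, u)`, with support in `[0, T) × 𝕋`. They are given on
`ℝ × 𝕋`; every `C^1` function on `[0, T] × 𝕋` is the restriction of such a function. -/
structure IsTestFunction (T : ℝ) (w : ℝ → Torus → ℝ) : Prop where
  contDiff : ContDiff ℝ 1 (fun p : ℝ × ℝ => w p.1 (p.2 : Torus))
  support : ∃ T' < T, ∀ t ≥ T', ∀ u, w t u = 0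

/-- Weak solutions `ρ : [0, T] × 𝕋 × Ω → ℝ` of
`∂_t ρ = - ∂_u (ρ V)`, `ρ(0, u, x) = ρ₀(u, x)`. The two `integrable` fields express that the
integrals in the definition exist: `ρ(t, ·, x)` is integrable on the circle for all `t`, and
`ρ` is integrable for `dt du dν_x`, which is what `V(·, ·, x)` needs. -/
structure IsWeakSolution (m : Measure Ω) (ν : Kernel Ω Ω) (C : ℝ) (D : Torus → ℝ) (T : ℝ)
    (ρ₀ : Torus → Ω → ℝ) (ρ : Set.Icc (0 : ℝ) T → Torus → Ω → ℝ) : Prop where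
  measurable : Measurable (fun p : Set.Icc (0 : ℝ) T × Torus × Ω => ρ p.1 p.2.1 p.2.2)
  integrable : ∀ᵐ x ∂m, ∀ t, Integrable (fun u : Torus => ρ t u x)
  integrable_fiber : ∀ᵐ x ∂m,
    Integrable (fun p : Set.Icc (0 : ℝ) T × Torus × Ω => ρ p.1 p.2.1 p.2.2)
      ((timeMeasure T).prod ((volume : Measure Torus).prod (ν x)))
  weak_continuous : ∀ᵐ x ∂m, ∀ f : C(Torus, ℝ), Continuous (fun t => ∫ u : Torus, ρ t u x * f u)
  weak_eq : ∀ᵐ x ∂m, ∀ w : ℝ → Torus → ℝ, IsTestFunction T w →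
    (∫ t : Set.Icc (0 : ℝ) T, (∫ u : Torus,
        ρ t u x * (deriv (fun s : ℝ => w s u) (t : ℝ)
          + charField ν C D ρ t u x * torusDeriv (w (t : ℝ)) u)) ∂(timeMeasure T))
      + ∫ u : Torus, w 0 u * ρ₀ u x = 0

end Graphop

end GraphopVFPE

end

/-!
The idea is to work at one node `x` at a time and to replace densities by flows. All estimates on
the nonlinear problem are made on the real displacements `ξ (t, u, x)` of the characteristics, where
the problem is an integral equation in `ℝ`, and are carried over to densities by push-forward.

*Representation.* Fix a node `x` outside a null set and a weak solution `σ`. Weak continuity and the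
uniform boundedness principle bound `σ (t, ·, x)` in `L¹` uniformly in `t`, and the characteristic
field at `x` is bounded and Lipschitz in space by an integrable function `L` of time, since `D` is
bounded and Lipschitz and `σ` is integrable for `dt du dν_x`. Hence `σ (·, ·, x)` solves a *linear*
continuity equation with a field that is Lipschitz in space. So does the push-forward of the initial
measure by the flow of this field, which has a density because the flow is antilipschitz. The two
agree (`IsFlow.map_eq_withDensity_of_continuityEquation`): if `d` is the difference of two solutions
and `v` the field, then `F = -∫₀ᵗ d v` is a primitive of `d` in space, so `∂ₜF + v ∂ᵤF = 0`, and
Gronwall's lemma for `∫ F²` gives `F = 0` (`ae_eq_zero_of_continuityEquation`). Thus almost every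
fiber of `σ` is the initial measure transported by the flow of the field of `σ`, in particular it is
nonnegative with the mass of the initial measure (`IsWeakSolution.exists_isTransported`). No bound
on `σ` that is uniform in `x` enters.

*Uniqueness.* A null set of nodes is `ν_x`-null for almost every `x`, because the graphop maps its
indicator to zero (`IsFiberFamily.ae_ae`). So the representation holds at almost every node and at
`ν_x`-almost all nodes which it interacts with. With the weight `e^{2Λ}`, `Λ' = 2 C b` on `[0, T]`,
the map which assigns to displacements the displacements along the field they generate contracts by
`1/2`, as `ν_x(Ω) ≤ 1` and the initial masses are at most `b` (`abs_displacement_sub_le`). The bound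
`|D| ≤ 1` starts the iteration, and the displacements of two solutions agree almost everywhere.

*Existence.* The same contraction, on displacements that are measurable in `(t, u, x)`, has a fixed
point (`exists_isFlow_meanField`). The flows are antilipschitz on the circle, so the transported
measures have densities, which are jointly measurable in `(t, u, x)` by the Radon–Nikodym theorem
for kernels (`exists_measurable_density`); the density is a weak solution by
`IsFlow.integral_transport`.
-/

noncomputable section

namespace GraphopVFPE

open Filter Topology Set intervalIntegral

/-! ### Calculus along absolutely continuous curves -/

/-- A `C¹` function of two absolutely continuous functions is absolutely continuous. -/
theorem absolutelyContinuousOnInterval_comp₂ {W : ℝ × ℝ → ℝ} (hW : ContDiff ℝ 1 W)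
    {p q : ℝ → ℝ} {a b : ℝ} (hp : AbsolutelyContinuousOnInterval p a b)
    (hq : AbsolutelyContinuousOnInterval q a b) :
    AbsolutelyContinuousOnInterval (fun t => W (p t, q t)) a b := by
  obtain ⟨R, hR⟩ := hp.exists_bound
  obtain ⟨S, hS⟩ := hq.exists_bound
  have hconv : Convex ℝ (Icc (-R) R ×ˢ Icc (-S) S) := (convex_Icc _ _).prod (convex_Icc _ _)
  obtain ⟨K, hK⟩ := (hW.contDiffOn (s := Icc (-R) R ×ˢ Icc (-S) S)).exists_lipschitzOnWith
    (by decide) hconv (isCompact_Icc.prod isCompact_Icc)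
  have hmem : ∀ t ∈ uIcc a b, (p t, q t) ∈ Icc (-R) R ×ˢ Icc (-S) S := fun t ht =>
    ⟨abs_le.1 (hR t ht), abs_le.1 (hS t ht)⟩
  have hdist : ∀ s ∈ uIcc a b, ∀ t ∈ uIcc a b,
      dist (W (p s, q s)) (W (p t, q t)) ≤ K * (dist (p s) (p t) + dist (q s) (q t)) := by
    intro s hs t ht
    refine (hK.dist_le_mul _ (hmem s hs) _ (hmem t ht)).trans ?_
    gcongr
    rw [Prod.dist_eq]
    exact max_le_add_of_nonneg (α := ℝ) dist_nonneg dist_nonneg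
  unfold AbsolutelyContinuousOnInterval at hp hq ⊢
  have hlim := (hp.add hq).const_mul (K : ℝ)
  rw [add_zero, mul_zero] at hlim
  refine squeeze_zero' (Eventually.of_forall fun E => Finset.sum_nonneg fun _ _ => dist_nonneg) ?_ hlim
  refine mem_inf_of_right (fun (E : ℕ × (ℕ → ℝ × ℝ)) hE => ?_)
  show ∑ i ∈ Finset.range E.1, dist (W (p (E.2 i).1, q (E.2 i).1)) (W (p (E.2 i).2, q (E.2 i).2)) ≤
    K * (∑ i ∈ Finset.range E.1, dist (p (E.2 i).1) (p (E.2 i).2)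
      + ∑ i ∈ Finset.range E.1, dist (q (E.2 i).1) (q (E.2 i).2))
  rw [← Finset.sum_add_distrib, Finset.mul_sum]
  refine Finset.sum_le_sum fun i hi => ?_
  exact hdist _ (hE.1 i hi).1 _ (hE.1 i hi).2

/-- Fundamental theorem of calculus along the curve `(p, q)`, whose coordinates are primitives of
the integrable functions `f` and `g`. -/
theorem integral_fderiv_comp {W : ℝ × ℝ → ℝ} (hW : ContDiff ℝ 1 W)
    {p q f g : ℝ → ℝ} {a b : ℝ}
    (hf : IntervalIntegrable f volume a b) (hg : IntervalIntegrable g volume a b)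
    (hp : ∀ t ∈ uIcc a b, p t = p a + ∫ s in a..t, f s)
    (hq : ∀ t ∈ uIcc a b, q t = q a + ∫ s in a..t, g s) :
    IntervalIntegrable (fun s => fderiv ℝ W (p s, q s) (f s, g s)) volume a b ∧
    ∫ s in a..b, fderiv ℝ W (p s, q s) (f s, g s) = W (p b, q b) - W (p a, q a) := by
  set P : ℝ → ℝ := fun t => p a + ∫ s in a..t, f s with hP
  set Q : ℝ → ℝ := fun t => q a + ∫ s in a..t, g s with hQ
  have hPac : AbsolutelyContinuousOnInterval P a b :=
    AbsolutelyContinuousOnInterval.fun_add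
      ((LipschitzWith.const (p a)).lipschitzOnWith.absolutelyContinuousOnInterval)
      (hf.absolutelyContinuousOnInterval_intervalIntegral (c := a) (by simp))
  have hQac : AbsolutelyContinuousOnInterval Q a b :=
    AbsolutelyContinuousOnInterval.fun_add
      ((LipschitzWith.const (q a)).lipschitzOnWith.absolutelyContinuousOnInterval)
      (hg.absolutelyContinuousOnInterval_intervalIntegral (c := a) (by simp))
  have hac := absolutelyContinuousOnInterval_comp₂ hW hPac hQac
  have hderiv : ∀ᵐ s, s ∈ uIoc a b →
      deriv (fun t => W (P t, Q t)) s = fderiv ℝ W (p s, q s) (f s, g s) := by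
    filter_upwards [hf.ae_hasDerivAt_integral, hg.ae_hasDerivAt_integral] with s h1 h2 hs
    have hs' := uIoc_subset_uIcc hs
    have e1 : HasDerivAt P (f s) s := (h1 hs' a (by simp)).const_add _
    have e2 : HasDerivAt Q (g s) s := (h2 hs' a (by simp)).const_add _
    have hWd : HasFDerivAt W (fderiv ℝ W (P s, Q s)) (P s, Q s) :=
      (hW.differentiable (by decide) _).hasFDerivAt
    have := (hWd.comp_hasDerivAt s (e1.prodMk e2)).deriv
    rw [hp s hs', hq s hs']
    exact this
  refine ⟨?_, ?_⟩
  · refine hac.intervalIntegrable_deriv.congr_ae ?_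
    rw [EventuallyEq, ae_restrict_iff' measurableSet_uIoc]
    exact hderiv
  · rw [← integral_congr_ae hderiv, hac.integral_deriv_eq_sub]
    simp only [hP, hQ]
    rw [← hp b (by simp), ← hq b (by simp)]
    simp

/-- The case `W (p, q) = q ^ 2`. -/
theorem integral_mul_self_primitive {q g : ℝ → ℝ} {a b : ℝ}
    (hg : IntervalIntegrable g volume a b) (hq : ∀ t ∈ uIcc a b, q t = q a + ∫ s in a..t, g s) :
    ∫ s in a..b, q s * g s = (q b ^ 2 - q a ^ 2) / 2 := by
  have hW : ContDiff ℝ 1 (fun z : ℝ × ℝ => z.2 ^ 2) := by fun_prop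
  have h := (integral_fderiv_comp hW hg hg hq hq).2
  have hd : ∀ z w : ℝ × ℝ, fderiv ℝ (fun z : ℝ × ℝ => z.2 ^ 2) z w = 2 * (z.2 * w.2) := by
    intro z w
    have : HasFDerivAt (fun z : ℝ × ℝ => z.2 ^ 2) _ z := (hasFDerivAt_snd (𝕜 := ℝ)).pow 2
    rw [this.fderiv]
    simp
    ring
  simp only [hd, intervalIntegral.integral_const_mul] at h
  linarith

/-- `∫₀ᵗ L e^{cΛ} = (e^{cΛ(t)} - 1)/c` for the primitive `Λ` of `L`. -/
theorem integral_mul_exp_primitive {L : ℝ → ℝ} (hL : Integrable L) {c : ℝ} (hc : c ≠ 0) (t : ℝ) :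
    IntervalIntegrable (fun s => L s * Real.exp (c * ∫ r in (0 : ℝ)..s, L r)) volume 0 t ∧
    ∫ s in (0 : ℝ)..t, L s * Real.exp (c * ∫ r in (0 : ℝ)..s, L r)
      = (Real.exp (c * ∫ r in (0 : ℝ)..t, L r) - 1) / c := by
  have hW : ContDiff ℝ 1 (fun z : ℝ × ℝ => Real.exp (c * z.2)) := by fun_prop
  have hq : ∀ r ∈ uIcc 0 t, (fun s => ∫ r in (0 : ℝ)..s, L r) r
      = (fun s => ∫ r in (0 : ℝ)..s, L r) 0 + ∫ s in (0 : ℝ)..r, L s := by simp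
  have h := integral_fderiv_comp hW (hL.intervalIntegrable (a := 0) (b := t))
    (hL.intervalIntegrable (a := 0) (b := t)) hq hq
  have hd : ∀ z w : ℝ × ℝ, fderiv ℝ (fun z : ℝ × ℝ => Real.exp (c * z.2)) z w
      = c * (w.2 * Real.exp (c * z.2)) := by
    intro z w
    have : HasFDerivAt (fun z : ℝ × ℝ => Real.exp (c * z.2)) _ z :=
      ((hasFDerivAt_snd (𝕜 := ℝ)).const_mul c).exp
    rw [this.fderiv]
    simp
    ring
  simp only [hd, intervalIntegral.integral_const_mul, integral_same, mul_zero,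
    Real.exp_zero] at h
  refine ⟨?_, by rw [eq_div_iff hc, mul_comm]; exact h.2⟩
  have := h.1.const_mul c⁻¹
  simpa [← mul_assoc, inv_mul_cancel₀ hc] using this

/-! ### Weighted contraction -/

/-- The weight `e^{2Λ(t)}`, `Λ(t) = ∫₀ᵗ L`, frozen for negative times. Integrating `L` against it
gains a factor `1/2`. -/
def expWeight (L : ℝ → ℝ) (t : ℝ) : ℝ := Real.exp (2 * ∫ r in (0 : ℝ)..max t 0, L r)

theorem expWeight_pos (L : ℝ → ℝ) (t : ℝ) : 0 < expWeight L t := Real.exp_pos _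

theorem one_le_expWeight {L : ℝ → ℝ} (hL0 : ∀ s, 0 ≤ L s) (t : ℝ) : 1 ≤ expWeight L t :=
  Real.one_le_exp (mul_nonneg zero_le_two
    (integral_nonneg (le_max_right _ _) fun s _ => hL0 s))

/-- Integration in time against the rate `L` contracts the norm with weight `expWeight L`. -/
theorem abs_integral_le_half_expWeight {L : ℝ → ℝ} (hL : Integrable L)
    {h : ℝ → ℝ} {K : ℝ} {t : ℝ} (hK : 0 ≤ K)
    (hh : ∀ᵐ s, s ∈ Ioc 0 (max t 0) → |h s| ≤ L s * (K * expWeight L s)) :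
    |∫ s in (0 : ℝ)..max t 0, h s| ≤ K / 2 * expWeight L t := by
  have ht : 0 ≤ max t 0 := le_max_right _ _
  obtain ⟨h1, h2⟩ := integral_mul_exp_primitive hL (two_ne_zero (α := ℝ)) (max t 0)
  have h3 : |∫ s in (0 : ℝ)..max t 0, h s|
      ≤ ∫ s in (0 : ℝ)..max t 0, K * (L s * Real.exp (2 * ∫ r in (0 : ℝ)..s, L r)) := by
    rw [← Real.norm_eq_abs]
    refine norm_integral_le_of_norm_le ht ?_ (h1.const_mul K)
    filter_upwards [hh] with s hs hs'
    rw [Real.norm_eq_abs]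
    refine (hs hs').trans (le_of_eq ?_)
    rw [expWeight, max_eq_left hs'.1.le]
    ring
  refine h3.trans ?_
  rw [intervalIntegral.integral_const_mul, h2, expWeight]
  have : K * ((Real.exp (2 * ∫ r in (0 : ℝ)..max t 0, L r) - 1) / 2)
      = K / 2 * Real.exp (2 * ∫ r in (0 : ℝ)..max t 0, L r) - K / 2 := by ring
  rw [this]
  linarith

/-- A quantity bounded by `K / 2 ^ n` times a fixed number for all `n` vanishes. -/
theorem eq_zero_of_forall_abs_le_half_pow {x K w : ℝ} (h : ∀ n : ℕ, |x| ≤ K / 2 ^ n * w) :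
    x = 0 := by
  have hlim : Tendsto (fun n : ℕ => K / 2 ^ n * w) atTop (𝓝 0) := by
    have := ((tendsto_pow_atTop_nhds_zero_of_lt_one (r := (1 / 2 : ℝ)) (by norm_num)
      (by norm_num)).const_mul K).mul_const w
    simpa [div_eq_mul_inv] using this
  exact abs_nonpos_iff.1 (ge_of_tendsto' hlim h)

/-- Gronwall's lemma with an integrable rate. No measurability of `e` is needed. -/
theorem eq_zero_of_le_integral {L e : ℝ → ℝ} (hL : Integrable L) (hL0 : ∀ s, 0 ≤ L s)
    {T M : ℝ} (he0 : ∀ t ∈ Icc 0 T, 0 ≤ e t) (heM : ∀ t ∈ Icc 0 T, e t ≤ M)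
    (he : ∀ t ∈ Icc 0 T, e t ≤ ∫ s in (0 : ℝ)..t, L s * e s) :
    ∀ t ∈ Icc 0 T, e t = 0 := by
  have key : ∀ n : ℕ, ∀ t ∈ Icc 0 T, e t ≤ |M| / 2 ^ n * expWeight L t := by
    intro n
    induction n with
    | zero =>
      intro t ht
      simp only [pow_zero, div_one]
      nlinarith [one_le_expWeight hL0 t, heM t ht, le_abs_self M, abs_nonneg M]
    | succ n ih =>
      intro t ht
      refine (he t ht).trans ((le_abs_self _).trans ?_)
      have hm : max t 0 = t := max_eq_left ht.1
      have := abs_integral_le_half_expWeight hL (h := fun s => L s * e s) (t := t)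
        (K := |M| / 2 ^ n) (by positivity) (Eventually.of_forall fun s hs => by
          rw [hm] at hs
          have hs' : s ∈ Icc 0 T := ⟨hs.1.le, hs.2.trans ht.2⟩
          rw [abs_of_nonneg (mul_nonneg (hL0 s) (he0 s hs'))]
          exact mul_le_mul_of_nonneg_left (ih s hs') (hL0 s))
      rw [hm] at this
      rw [pow_succ, ← div_div]
      exact this
  intro t ht
  refine eq_zero_of_forall_abs_le_half_pow (K := |M|) (w := expWeight L t) fun n => ?_
  rw [abs_of_nonneg (he0 t ht)]
  exact key n t ht

/-- Picard iteration for an operator on measurable functions that contracts a weighted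
supremum norm by `1/2`. -/
theorem exists_measurable_fixedPoint {α : Type*} [MeasurableSpace α] (w : α → ℝ)
    (𝒯 : (α → ℝ) → α → ℝ)
    (hmeas : ∀ ξ, Measurable ξ → Measurable (𝒯 ξ))
    (hcontr : ∀ ξ η, Measurable ξ → Measurable η → ∀ K, 0 ≤ K →
      (∀ a, |ξ a - η a| ≤ K * w a) → ∀ a, |𝒯 ξ a - 𝒯 η a| ≤ K / 2 * w a)
    {K : ℝ} (hK : 0 ≤ K) (hstart : ∀ a, |𝒯 0 a| ≤ K * w a) :
    ∃ ξ, Measurable ξ ∧ 𝒯 ξ = ξ := by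
  set X : ℕ → α → ℝ := fun n => 𝒯^[n] 0 with hX
  have hXs : ∀ n, X (n + 1) = 𝒯 (X n) := fun n => Function.iterate_succ_apply' 𝒯 n 0
  have hXm : ∀ n, Measurable (X n) := by
    intro n
    induction n with
    | zero => exact measurable_zero
    | succ n ih => rw [hXs]; exact hmeas _ ih
  have hstep : ∀ n a, |X n a - X (n + 1) a| ≤ K / 2 ^ n * w a := by
    intro n
    induction n with
    | zero =>
      intro a
      have : X 0 a - X 1 a = - 𝒯 0 a := by simp [hX]
      rw [zero_add, this, abs_neg]
      simpa using hstart a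
    | succ n ih =>
      intro a
      rw [hXs (n + 1), hXs n, pow_succ, ← div_div]
      have := hcontr _ _ (hXm n) (hXm (n + 1)) (K / 2 ^ n) (by positivity) ih a
      rwa [hXs n] at this
  have hgeo : ∀ a n, dist (X n a) (X (n + 1) a) ≤ (2 * K * w a) / 2 / 2 ^ n := by
    intro a n
    rw [Real.dist_eq]
    refine (hstep n a).trans (le_of_eq ?_)
    ring
  have hlim : ∀ a, ∃ l, Tendsto (fun n => X n a) atTop (𝓝 l) := fun a =>
    cauchySeq_tendsto_of_complete (cauchySeq_of_le_geometric_two (hgeo a))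
  choose ξ hξ using hlim
  have hξm : Measurable ξ :=
    measurable_of_tendsto_metrizable hXm (tendsto_pi_nhds.2 hξ)
  refine ⟨ξ, hξm, funext fun a => ?_⟩
  have hdist : ∀ n a, |X n a - ξ a| ≤ (2 * K) / 2 ^ n * w a := by
    intro n a
    have := dist_le_of_le_geometric_two_of_tendsto (hgeo a) (hξ a) n
    rw [Real.dist_eq] at this
    refine this.trans (le_of_eq ?_)
    ring
  have h1 : ∀ n : ℕ, |𝒯 ξ a - ξ a| ≤ (2 * K) / 2 ^ n * w a := by
    intro n
    have e1 := hcontr _ _ (hXm n) hξm ((2 * K) / 2 ^ n) (by positivity) (hdist n) a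
    have e2 := hdist (n + 1) a
    rw [hXs] at e2
    have e3 : |𝒯 ξ a - ξ a| ≤ |𝒯 (X n) a - 𝒯 ξ a| + |𝒯 (X n) a - ξ a| := by
      rw [abs_sub_comm (𝒯 (X n) a) (𝒯 ξ a)]
      exact abs_sub_le _ _ _
    refine e3.trans ((add_le_add e1 e2).trans (le_of_eq ?_))
    rw [pow_succ]
    ring
  exact sub_eq_zero.1 (eq_zero_of_forall_abs_le_half_pow h1)

/-! ### The circle -/

theorem norm_coe_torus_le (r : ℝ) : ‖(r : Torus)‖ ≤ |r| :=
  QuotientAddGroup.norm_mk_le_norm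

theorem dist_add_coe_le (u : Torus) (r s : ℝ) : dist (u + (r : Torus)) (u + (s : Torus)) ≤ |r - s| := by
  rw [dist_add_left, dist_eq_norm, ← AddCircle.coe_sub]
  exact norm_coe_torus_le _

theorem exists_lift_abs_eq_norm (u : Torus) : ∃ r : ℝ, (r : Torus) = u ∧ |r| = ‖u‖ := by
  obtain ⟨a, rfl⟩ := QuotientAddGroup.mk_surjective u
  refine ⟨a - round ((2 * Real.pi)⁻¹ * a) * (2 * Real.pi), ?_, ?_⟩
  · have : ((round ((2 * Real.pi)⁻¹ * a) * (2 * Real.pi) : ℝ) : Torus) = 0 := by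
      rw [← zsmul_eq_mul, AddCircle.coe_zsmul, AddCircle.coe_period, smul_zero]
    rw [AddCircle.coe_sub, this, sub_zero]
  · exact (AddCircle.norm_eq (2 * Real.pi)).symm

/-- Lebesgue measure and one-dimensional Hausdorff measure on the circle have the same null sets. -/
theorem volume_torus_eq_zero_iff (s : Set Torus) :
    volume s = 0 ↔ Measure.hausdorffMeasure 1 s = 0 := by
  constructor
  · intro h
    obtain ⟨s', hss', hs'm, hs'⟩ := exists_measurable_superset_of_null h
    have h1 : volume.restrict (Ioc (0 : ℝ) (0 + 2 * Real.pi)) (((↑) : ℝ → Torus) ⁻¹' s') = 0 := by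
      rw [(AddCircle.measurePreserving_mk (2 * Real.pi) 0).measure_preimage
        hs'm.nullMeasurableSet]
      exact hs'
    rw [Measure.restrict_apply (AddCircle.measurable_mk' hs'm)] at h1
    set P := ((↑) : ℝ → Torus) ⁻¹' s' ∩ Ioc (0 : ℝ) (0 + 2 * Real.pi)
    have hsub : s ⊆ ((↑) : ℝ → Torus) '' P := by
      intro u hu
      obtain ⟨a, ha, rfl⟩ : ∃ a ∈ Ioc (0 : ℝ) (0 + 2 * Real.pi), (a : Torus) = u := by
        have := AddCircle.coe_image_Ioc_eq (2 * Real.pi) 0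
        have hu' : u ∈ ((↑) : ℝ → Torus) '' Ioc (0 : ℝ) (0 + 2 * Real.pi) := by
          rw [this]; trivial
        exact hu'
      exact ⟨a, ⟨hss' hu, ha⟩, rfl⟩
    have hlip : LipschitzWith 1 ((↑) : ℝ → Torus) := LipschitzWith.of_dist_le_mul fun a b => by
      rw [dist_eq_norm, ← AddCircle.coe_sub, NNReal.coe_one, one_mul, Real.dist_eq]
      exact norm_coe_torus_le _
    refine measure_mono_null hsub (le_antisymm ?_ (zero_le))
    refine (hlip.hausdorffMeasure_image_le zero_le_one P).trans ?_
    rw [hausdorffMeasure_real, h1, mul_zero]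
  · intro h
    -- a set of diameter `δ` lies in a ball of radius `δ`, of length at most `2δ`
    have hle : (2 : ℝ≥0∞)⁻¹ • (volume : Measure Torus) ≤ Measure.hausdorffMeasure 1 := by
      refine Measure.le_hausdorffMeasure 1 _ 1 one_pos fun t ht => ?_
      rcases t.eq_empty_or_nonempty with rfl | ⟨x, hx⟩
      · simp
      have hfin : Metric.ediam t ≠ ∞ := ne_top_of_le_ne_top ENNReal.one_ne_top ht
      have hsub : t ⊆ Metric.closedBall x (Metric.ediam t).toReal := fun y hy => by
        rw [Metric.mem_closedBall, dist_edist]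
        exact ENNReal.toReal_mono hfin (Metric.edist_le_ediam_of_mem hy hx)
      have h2 : volume t ≤ 2 * Metric.ediam t := by
        refine (measure_mono hsub).trans ?_
        rw [AddCircle.volume_closedBall]
        refine (ENNReal.ofReal_le_ofReal (min_le_right _ _)).trans (le_of_eq ?_)
        rw [ENNReal.ofReal_mul zero_le_two, ENNReal.ofReal_toReal hfin]
        simp
      rw [Measure.smul_apply, smul_eq_mul, ENNReal.rpow_one]
      calc (2 : ℝ≥0∞)⁻¹ * volume t ≤ 2⁻¹ * (2 * Metric.ediam t) := by gcongr
        _ = Metric.ediam t := by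
          rw [← mul_assoc, ENNReal.inv_mul_cancel two_ne_zero ENNReal.ofNat_ne_top, one_mul]
    have h3 := hle s
    rw [h, Measure.smul_apply, smul_eq_mul] at h3
    simpa using h3

/-- An antilipschitz map of the circle pulls null sets back to null sets. -/
theorem volume_preimage_eq_zero_of_antilipschitz {g : Torus → Torus} {K : NNReal}
    (hg : AntilipschitzWith K g) {s : Set Torus} (hs : volume s = 0) : volume (g ⁻¹' s) = 0 := by
  rw [volume_torus_eq_zero_iff] at hs ⊢
  refine le_antisymm ((hg.hausdorffMeasure_preimage_le zero_le_one s).trans ?_) zero_le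
  rw [hs, mul_zero]

theorem torusDeriv_coe (f : Torus → ℝ) (a : ℝ) :
    torusDeriv f (a : Torus) = deriv (fun s : ℝ => f (s : Torus)) a := by
  unfold torusDeriv
  have := deriv_comp_const_add (f := fun s : ℝ => f (s : Torus)) a 0
  rw [add_zero] at this
  rw [← this]
  rfl

/-! ### Flows of vector fields on the circle that are Lipschitz in space -/

/-- A time-dependent vector field on the circle that is measurable in time and whose supremum and
spatial Lipschitz constant at time `s` are at most `L s`, with `L` integrable. -/
structure IsLipField (V : ℝ → Torus → ℝ) (L : ℝ → ℝ) : Prop where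
  measurable : Measurable (Function.uncurry V)
  integrable : Integrable L
  bound : ∀ s u, |V s u| ≤ L s
  lipschitz : ∀ s u v, |V s u - V s v| ≤ L s * dist u v

theorem IsLipField.nonneg {V : ℝ → Torus → ℝ} {L : ℝ → ℝ} (hV : IsLipField V L) (s : ℝ) :
    0 ≤ L s := (abs_nonneg _).trans (hV.bound s 0)

/-- The position at time `t` of the particle that starts at `u` and has travelled by the real
displacement `ξ t u`. -/
def position (ξ : ℝ → Torus → ℝ) (t : ℝ) (u : Torus) : Torus := u + (ξ t u : Torus)

/-- `ξ` is the displacement of the flow of `V`, started at time `0` and at rest before. Working with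
real displacements makes the characteristic equation an integral equation in `ℝ`. -/
structure IsFlow (V : ℝ → Torus → ℝ) (ξ : ℝ → Torus → ℝ) : Prop where
  measurable : Measurable (Function.uncurry ξ)
  eq_integral : ∀ t u, ξ t u = ∫ s in (0 : ℝ)..max t 0, V s (position ξ s u)

theorem measurable_position {ξ : ℝ → Torus → ℝ} (hξ : Measurable (Function.uncurry ξ)) :
    Measurable (Function.uncurry (position ξ)) :=
  measurable_snd.add (AddCircle.measurable_mk'.comp hξ)

theorem measurable_integral_zero_max {β : Type*} [MeasurableSpace β] {G : ℝ × β → ℝ}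
    (hG : Measurable G) : Measurable (fun p : ℝ × β => ∫ s in (0 : ℝ)..max p.1 0, G (s, p.2)) := by
  have h1 : (fun p : ℝ × β => ∫ s in (0 : ℝ)..max p.1 0, G (s, p.2))
      = fun p : ℝ × β => ∫ s, if 0 < s ∧ s ≤ p.1 then G (s, p.2) else 0 := by
    funext p
    rw [integral_of_le (le_max_right _ _), ← MeasureTheory.integral_indicator measurableSet_Ioc]
    congr 1
    funext s
    simp only [indicator_apply, mem_Ioc, le_max_iff]
    by_cases h : 0 < s
    · simp [h, not_le.2 h]
    · simp [h]
  rw [h1]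
  refine StronglyMeasurable.measurable ?_
  refine StronglyMeasurable.integral_prod_right
    (f := fun (p : ℝ × β) (s : ℝ) => if 0 < s ∧ s ≤ p.1 then G (s, p.2) else 0) ?_
  refine Measurable.stronglyMeasurable ?_
  refine Measurable.ite ?_ (hG.comp (measurable_snd.prodMk (measurable_snd.comp measurable_fst)))
    measurable_const
  exact (measurableSet_lt measurable_const measurable_snd).inter
    (measurableSet_le measurable_snd (measurable_fst.comp measurable_fst))

section Flow

variable {V : ℝ → Torus → ℝ} {L : ℝ → ℝ} {ξ : ℝ → Torus → ℝ}

theorem IsLipField.intervalIntegrable_position (hV : IsLipField V L)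
    (hξ : Measurable (Function.uncurry ξ)) (u : Torus) (a b : ℝ) :
    IntervalIntegrable (fun s => V s (position ξ s u)) volume a b := by
  refine Integrable.intervalIntegrable (hV.integrable.mono' ?_ (Eventually.of_forall fun s => ?_))
  · exact (hV.measurable.comp (measurable_id.prodMk ((measurable_position hξ).comp
      (measurable_id.prodMk measurable_const)))).aestronglyMeasurable
  · exact hV.bound _ _

theorem IsLipField.exists_isFlow (hV : IsLipField V L) : ∃ ξ, IsFlow V ξ := by
  set 𝒯 : (ℝ × Torus → ℝ) → ℝ × Torus → ℝ := fun ξ p =>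
    ∫ s in (0 : ℝ)..max p.1 0, V s (p.2 + (ξ (s, p.2) : Torus)) with h𝒯
  have hGm : ∀ ξ : ℝ × Torus → ℝ, Measurable ξ →
      Measurable (fun q : ℝ × Torus => V q.1 (q.2 + (ξ q : Torus))) := fun ξ hξ =>
    hV.measurable.comp (measurable_fst.prodMk (measurable_snd.add (AddCircle.measurable_mk'.comp hξ)))
  have hint : ∀ ξ : ℝ × Torus → ℝ, Measurable ξ → ∀ (u : Torus) (a b : ℝ),
      IntervalIntegrable (fun s => V s (u + (ξ (s, u) : Torus))) volume a b := fun ξ hξ u a b =>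
    hV.intervalIntegrable_position (ξ := fun s u => ξ (s, u)) hξ u a b
  obtain ⟨ξ, hξm, hξ⟩ := exists_measurable_fixedPoint (fun p : ℝ × Torus => expWeight L p.1) 𝒯
    (fun ξ hξ => measurable_integral_zero_max (hGm ξ hξ)) (fun ξ η hξ hη K hK h p => by
      simp only [h𝒯]
      rw [← integral_sub (hint ξ hξ _ _ _) (hint η hη _ _ _)]
      refine abs_integral_le_half_expWeight hV.integrable hK (Eventually.of_forall fun s _ => ?_)
      refine (hV.lipschitz s _ _).trans (mul_le_mul_of_nonneg_left ?_ (hV.nonneg s))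
      exact (dist_add_coe_le _ _ _).trans (h (s, p.2))) (K := 1) zero_le_one (fun p => by
      refine (abs_integral_le_half_expWeight hV.integrable zero_le_one
        (Eventually.of_forall fun s _ => ?_)).trans
        (mul_le_mul_of_nonneg_right (by norm_num) (expWeight_pos L p.1).le)
      refine (hV.bound s _).trans ?_
      have := one_le_expWeight hV.nonneg s
      nlinarith [hV.nonneg s])
  refine ⟨fun t u => ξ (t, u), hξm, fun t u => ?_⟩
  exact (congrFun hξ (t, u)).symm

namespace IsFlow

theorem eq_integral_of_nonneg (h : IsFlow V ξ) {t : ℝ} (ht : 0 ≤ t) (u : Torus) :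
    ξ t u = ∫ s in (0 : ℝ)..t, V s (position ξ s u) := by
  rw [h.eq_integral, max_eq_left ht]

theorem zero (h : IsFlow V ξ) (u : Torus) : ξ 0 u = 0 := by
  rw [h.eq_integral]; simp

theorem position_zero (h : IsFlow V ξ) (u : Torus) : position ξ 0 u = u := by
  simp [position, h.zero]

theorem continuous (h : IsFlow V ξ) (hV : IsLipField V L) (u : Torus) :
    Continuous (fun t => ξ t u) := by
  have h1 : Continuous (fun t => ∫ s in (0 : ℝ)..t, V s (position ξ s u)) :=
    continuous_primitive (fun a b => hV.intervalIntegrable_position h.measurable u a b) 0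
  have h2 : (fun t => ξ t u) = fun t => ∫ s in (0 : ℝ)..max t 0, V s (position ξ s u) :=
    funext fun t => h.eq_integral t u
  rw [h2]
  exact h1.comp (continuous_id.max continuous_const)

theorem continuous_position (h : IsFlow V ξ) (hV : IsLipField V L) (u : Torus) :
    Continuous (fun t => position ξ t u) :=
  continuous_const.add ((AddCircle.continuous_mk' _).comp (h.continuous hV u))

/-- Trajectories separate at most exponentially when time runs backwards: for the real distance `z`
of two lifted trajectories, `z² e^{2Λ}` is nondecreasing. -/
theorem antilipschitz (h : IsFlow V ξ) (hV : IsLipField V L) {t : ℝ} (ht : 0 ≤ t) :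
    ∃ K : NNReal, AntilipschitzWith K (position ξ t) := by
  refine ⟨(Real.exp (∫ r in (0 : ℝ)..t, L r)).toNNReal, AntilipschitzWith.of_le_mul_dist fun u v => ?_⟩
  rw [Real.coe_toNNReal _ (Real.exp_pos _).le]
  obtain ⟨r, hr, hrn⟩ := exists_lift_abs_eq_norm (position ξ t u - position ξ t v)
  rw [dist_eq_norm, dist_eq_norm, ← hrn]
  set z : ℝ → ℝ := fun s => r - (ξ t u - ξ t v) + (ξ s u - ξ s v) with hz
  have hzt : z t = r := by simp [hz]
  have hzc : ∀ s, (z s : Torus) = position ξ s u - position ξ s v := by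
    intro s
    simp only [hz, AddCircle.coe_add, AddCircle.coe_sub, hr, position]
    abel
  have hz0 : ‖u - v‖ ≤ |z 0| := by
    have := norm_coe_torus_le (z 0)
    rwa [hzc, h.position_zero, h.position_zero] at this
  set f : ℝ → ℝ := fun s => V s (position ξ s u) - V s (position ξ s v) with hf
  have hfz : ∀ s, |f s| ≤ L s * |z s| := by
    intro s
    refine (hV.lipschitz s _ _).trans (mul_le_mul_of_nonneg_left ?_ (hV.nonneg s))
    rw [dist_eq_norm, ← hzc]
    exact norm_coe_torus_le _
  have hiu := hV.intervalIntegrable_position h.measurable u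
  have hiv := hV.intervalIntegrable_position h.measurable v
  have hW : ContDiff ℝ 1 (fun y : ℝ × ℝ => y.1 ^ 2 * Real.exp (2 * y.2)) := by fun_prop
  have hzint : ∀ s ∈ uIcc 0 t, z s = z 0 + ∫ s in (0 : ℝ)..s, f s := by
    intro s hs
    rw [uIcc_of_le ht] at hs
    rw [integral_sub (hiu _ _) (hiv _ _), ← h.eq_integral_of_nonneg hs.1,
      ← h.eq_integral_of_nonneg hs.1]
    simp [hz, h.zero]
  have hq : ∀ r ∈ uIcc 0 t, (fun s => ∫ r in (0 : ℝ)..s, L r) r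
      = (fun s => ∫ r in (0 : ℝ)..s, L r) 0 + ∫ s in (0 : ℝ)..r, L s := by simp
  have hd : ∀ y w : ℝ × ℝ, fderiv ℝ (fun y : ℝ × ℝ => y.1 ^ 2 * Real.exp (2 * y.2)) y w
      = 2 * Real.exp (2 * y.2) * (y.1 * w.1 + w.2 * y.1 ^ 2) := by
    intro y w
    have h1 : HasFDerivAt (fun y : ℝ × ℝ => y.1 ^ 2) _ y := (hasFDerivAt_fst (𝕜 := ℝ)).pow 2
    have h2 : HasFDerivAt (fun y : ℝ × ℝ => Real.exp (2 * y.2)) _ y :=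
      ((hasFDerivAt_snd (𝕜 := ℝ)).const_mul 2).exp
    have h3 : fderiv ℝ (fun y : ℝ × ℝ => y.1 ^ 2 * Real.exp (2 * y.2)) y = _ := (h1.mul h2).fderiv
    rw [h3]
    simp
    ring
  have key := (integral_fderiv_comp hW ((hiu 0 t).sub (hiv 0 t))
    (hV.integrable.intervalIntegrable (a := 0) (b := t)) hzint hq).2
  have hpos : 0 ≤ ∫ s in (0 : ℝ)..t, fderiv ℝ (fun y : ℝ × ℝ => y.1 ^ 2 * Real.exp (2 * y.2))
      (z s, (fun s => ∫ r in (0 : ℝ)..s, L r) s) (f s, L s) := by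
    refine integral_nonneg ht fun s _ => ?_
    rw [hd]
    refine mul_nonneg (by positivity) ?_
    have h1 : |z s * f s| ≤ L s * (z s) ^ 2 := by
      rw [abs_mul, ← sq_abs (z s)]
      nlinarith [hfz s, abs_nonneg (z s)]
    have h2 := neg_abs_le (z s * f s)
    show 0 ≤ z s * f s + L s * z s ^ 2
    linarith
  erw [key] at hpos
  simp only [integral_same, mul_zero, Real.exp_zero, mul_one, hzt] at hpos
  refine hz0.trans (abs_le_of_sq_le_sq' ?_ (by positivity)).2 |>.trans' (le_of_eq rfl)
  rw [sq_abs, mul_pow, sq_abs, ← Real.exp_nat_mul]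
  push_cast
  linarith

/-- Derivative of a test function along the trajectories, in integrated form. -/
theorem integral_deriv_position (h : IsFlow V ξ) (hV : IsLipField V L) {w : ℝ → Torus → ℝ}
    (hw : ContDiff ℝ 1 (fun p : ℝ × ℝ => w p.1 (p.2 : Torus))) {t : ℝ} (ht : 0 ≤ t) (u : Torus) :
    ∫ s in (0 : ℝ)..t, (deriv (fun r : ℝ => w r (position ξ s u)) s
        + V s (position ξ s u) * torusDeriv (w s) (position ξ s u))
      = w t (position ξ t u) - w 0 u := by
  obtain ⟨a, rfl⟩ := QuotientAddGroup.mk_surjective u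
  set y : ℝ → ℝ := fun s => a + ξ s (a : Torus) with hy
  have hyc : ∀ s, position ξ s (a : Torus) = (y s : Torus) := fun s => by
    simp [position, hy]
  have hyint : ∀ s ∈ uIcc 0 t, y s = y 0 + ∫ r in (0 : ℝ)..s, V r (y r : Torus) := by
    intro s hs
    rw [uIcc_of_le ht] at hs
    simp only [← hyc, ← h.eq_integral_of_nonneg hs.1]
    simp [hy, h.zero]
  have hid : ∀ s ∈ uIcc 0 t, (fun s : ℝ => s) s = (fun s : ℝ => s) 0 + ∫ r in (0 : ℝ)..s, (1 : ℝ) := by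
    simp
  have hi := hV.intervalIntegrable_position h.measurable (a : Torus) 0 t
  simp only [hyc] at hi
  have key := (integral_fderiv_comp hw (intervalIntegrable_const (c := (1 : ℝ))) hi hid hyint).2
  have h0 : y 0 = a := by simp [hy, h.zero]
  have hd : ∀ s b f : ℝ, fderiv ℝ (fun p : ℝ × ℝ => w p.1 (p.2 : Torus)) (s, b) (1, f)
      = deriv (fun r : ℝ => w r (b : Torus)) s + f * torusDeriv (w s) (b : Torus) := by
    intro s b f
    have hF := (hw.differentiable (by decide) (s, b)).hasFDerivAt
    have e1 : deriv (fun r : ℝ => w r (b : Torus)) s = _ :=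
      (hF.comp_hasDerivAt (f := fun r : ℝ => (r, b)) s
        ((hasDerivAt_id s).prodMk (hasDerivAt_const s b))).deriv
    have e2 : deriv (fun c : ℝ => w s (c : Torus)) b = _ :=
      (hF.comp_hasDerivAt (f := fun c : ℝ => (s, c)) b
        ((hasDerivAt_const b s).prodMk (hasDerivAt_id b))).deriv
    have e3 : ((1 : ℝ), f) = (1, 0) + f • ((0 : ℝ), (1 : ℝ)) := by simp
    rw [torusDeriv_coe, e1, e2, e3, map_add, map_smul, smul_eq_mul]
  rw [h0] at key
  rw [hyc t]
  refine Eq.trans ?_ key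
  simp only [hd]
  exact integral_congr fun s _ => by rw [hyc s]

end IsFlow

end Flow

/-! ### Densities of transported families of measures -/

/-- A family of finite measures with an antilipschitz transport map on the circle has a jointly
measurable density if the initial family does. -/
theorem exists_measurable_density {S : Type*} [MeasurableSpace S] {μ : Kernel S Torus}
    [IsFiniteKernel μ] (hμ : ∀ s, μ s ≪ volume) {g : S → Torus → Torus}
    (hg : Measurable (Function.uncurry g)) (hanti : ∀ s, ∃ K, AntilipschitzWith K (g s)) :
    ∃ p : S → Torus → ℝ, Measurable (Function.uncurry p) ∧ (∀ s u, 0 ≤ p s u) ∧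
      ∀ s, (μ s).map (g s) = volume.withDensity (fun u => ENNReal.ofReal (p s u)) := by
  set κ : Kernel S Torus := (Kernel.id ×ₖ μ).map (Function.uncurry g) with hκ
  have hgs : ∀ s, Measurable (g s) := fun s => hg.of_uncurry_left
  have hκs : ∀ s, κ s = (μ s).map (g s) := by
    intro s
    rw [hκ, Kernel.map_apply _ hg, Kernel.prod_apply, Kernel.id_apply, Measure.dirac_prod,
      Measure.map_map hg (by fun_prop)]
    rfl
  have : IsFiniteKernel κ := by rw [hκ]; infer_instance
  have hac : ∀ s, κ s ≪ (Kernel.const S (volume : Measure Torus)) s := by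
    intro s
    rw [Kernel.const_apply, hκs]
    refine Measure.AbsolutelyContinuous.mk fun t ht ht0 => ?_
    rw [Measure.map_apply (hgs s) ht]
    obtain ⟨K, hK⟩ := hanti s
    exact hμ s (volume_preimage_eq_zero_of_antilipschitz hK ht0)
  refine ⟨fun s u => (κ.rnDeriv (Kernel.const S volume) s u).toReal,
    (Kernel.measurable_rnDeriv _ _).ennreal_toReal, fun _ _ => ENNReal.toReal_nonneg, fun s => ?_⟩
  have h1 := Kernel.withDensity_rnDeriv_eq (hac s)
  rw [Kernel.withDensity_apply _ (Kernel.measurable_rnDeriv _ _), Kernel.const_apply, hκs] at h1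
  rw [← h1]
  refine withDensity_congr_ae ?_
  have h2 := Kernel.rnDeriv_ne_top κ (Kernel.const S (volume : Measure Torus)) (a := s)
  rw [Kernel.const_apply] at h2
  filter_upwards [h2] with u hu
  rw [ENNReal.ofReal_toReal hu]

theorem integral_withDensity_ofReal {g : Torus → ℝ} (hg : Measurable g) (hg0 : ∀ᵐ u, 0 ≤ g u)
    (f : Torus → ℝ) :
    ∫ u, f u ∂(volume.withDensity fun u => ENNReal.ofReal (g u)) = ∫ u, g u * f u := by
  rw [integral_withDensity_eq_integral_toReal_smul hg.ennreal_ofReal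
    (Eventually.of_forall fun _ => ENNReal.ofReal_lt_top)]
  refine MeasureTheory.integral_congr_ae ?_
  filter_upwards [hg0] with u hu
  rw [ENNReal.toReal_ofReal hu, smul_eq_mul]

/-! ### Uniqueness for the linear continuity equation on an interval with periodic test functions -/

/-- The du Bois-Reymond lemma for periodic test functions. -/
theorem exists_ae_eq_const_of_integral_mul_deriv_eq_zero {ℓ : ℝ} (hℓ : 0 < ℓ) {f : ℝ → ℝ}
    (hf : IntervalIntegrable f volume 0 ℓ)
    (h : ∀ φ : ℝ → ℝ, ContDiff ℝ 1 φ → Function.Periodic φ ℓ →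
      ∫ a in (0 : ℝ)..ℓ, f a * deriv φ a = 0) :
    ∃ c, ∀ᵐ a ∂(volume.restrict (Ioc 0 ℓ)), f a = c := by
  set c := ℓ⁻¹ * ∫ a in (0 : ℝ)..ℓ, f a with hc
  have hfi : IntegrableOn f (Ioc 0 ℓ) := (intervalIntegrable_iff_integrableOn_Ioc_of_le hℓ.le).1 hf
  refine ⟨c, ?_⟩
  suffices H : ∀ᵐ a, a ∈ Ioo 0 ℓ → f a - c = 0 by
    rw [← restrict_Ioo_eq_restrict_Ioc, ae_restrict_iff' measurableSet_Ioo]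
    filter_upwards [H] with a ha h' using sub_eq_zero.1 (ha h')
  have hloc : LocallyIntegrableOn (fun a => f a - c) (Ioo 0 ℓ) := by
    refine IntegrableOn.locallyIntegrableOn ?_
    exact (hfi.mono_set Ioo_subset_Ioc_self).sub (by simp)
  refine isOpen_Ioo.ae_eq_zero_of_integral_contDiff_smul_eq_zero hloc fun g hg _ hgs => ?_
  have hgz : ∀ a, a ∉ Ioo 0 ℓ → g a = 0 := fun a ha =>
    image_eq_zero_of_notMem_tsupport fun h' => ha (hgs h')
  have hg0 : g 0 = 0 := hgz 0 (by simp)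
  have hgℓ : g ℓ = 0 := hgz ℓ (by simp)
  -- the primitive of the periodization of `g`, minus its mean, is a test function
  have : Fact (0 < ℓ) := ⟨hℓ⟩
  set m := ℓ⁻¹ * ∫ a in (0 : ℝ)..ℓ, g a with hm
  set G : ℝ → ℝ := fun a => AddCircle.liftIco ℓ 0 g (a : AddCircle ℓ) - m with hG
  have hGc : Continuous G := ((AddCircle.liftIco_zero_continuous (hg0.trans hgℓ.symm)
    hg.continuous.continuousOn).comp (AddCircle.continuous_mk' ℓ)).sub continuous_const
  have hGp : Function.Periodic G ℓ := fun a => by simp [hG]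
  have hGeq : ∀ a ∈ Icc 0 ℓ, G a = g a - m := by
    intro a ha
    rcases eq_or_lt_of_le ha.2 with rfl | hlt
    · have e1 : ((a : ℝ) : AddCircle a) = ((0 : ℝ) : AddCircle a) := by simp
      simp only [hG, e1]
      rw [AddCircle.liftIco_coe_apply (by simp [hℓ]), hg0, hgℓ]
    · simp only [hG]
      rw [AddCircle.liftIco_coe_apply (by simpa using ⟨ha.1, hlt⟩)]
  have hgi : IntervalIntegrable g volume 0 ℓ := hg.continuous.intervalIntegrable _ _
  have hGint : ∫ a in (0 : ℝ)..ℓ, G a = 0 := by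
    rw [integral_congr (g := fun a => g a - m) fun a ha => hGeq a (by rwa [uIcc_of_le hℓ.le] at ha),
      integral_sub hgi intervalIntegrable_const, intervalIntegral.integral_const, hm,
      smul_eq_mul, sub_zero, ← mul_assoc, mul_inv_cancel₀ hℓ.ne', one_mul, sub_self]
  set φ : ℝ → ℝ := fun a => ∫ b in (0 : ℝ)..a, G b with hφ
  have hφd : ∀ a, HasDerivAt φ (G a) a := fun a => hGc.integral_hasStrictDerivAt 0 a |>.hasDerivAt
  have hφderiv : deriv φ = G := funext fun a => (hφd a).deriv
  have hφC : ContDiff ℝ 1 φ := by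
    rw [contDiff_one_iff_deriv]
    exact ⟨fun a => (hφd a).differentiableAt, hφderiv ▸ hGc⟩
  have hφp : Function.Periodic φ ℓ := by
    intro a
    have h1 := integral_add_adjacent_intervals (hGc.intervalIntegrable (μ := volume) 0 a)
      (hGc.intervalIntegrable a (a + ℓ))
    have h2 := hGp.intervalIntegral_add_eq a 0
    rw [zero_add, hGint] at h2
    simp only [hφ]
    rw [← h1, h2, add_zero]
  have key := h φ hφC hφp
  have hfg : IntervalIntegrable (fun a => f a * g a) volume 0 ℓ :=
    hf.mul_continuousOn hg.continuous.continuousOn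
  rw [hφderiv, integral_congr (g := fun a => f a * g a - f a * m) fun a ha => by
      rw [uIcc_of_le hℓ.le] at ha
      simp only [hGeq a ha]; ring,
    integral_sub hfg (hf.mul_const m), intervalIntegral.integral_mul_const] at key
  have h3 : ∫ a, g a • (f a - c) = ∫ a in (0 : ℝ)..ℓ, (f a * g a - c * g a) := by
    rw [integral_of_le hℓ.le, setIntegral_eq_integral_of_forall_compl_eq_zero]
    · refine MeasureTheory.integral_congr_ae (Eventually.of_forall fun a => ?_)
      simp only [smul_eq_mul]; ring
    · intro a ha
      rw [hgz a fun h' => ha (Ioo_subset_Ioc_self h')]; ring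
  rw [h3, integral_sub hfg (hgi.const_mul c), intervalIntegral.integral_const_mul]
  rw [hm] at key
  rw [hc]
  linear_combination key

/-- Integration by parts for `Q Q' v` when `v` is Lipschitz and `Q²`, `v` take the same values at
both ends. -/
theorem abs_integral_primitive_mul_le {ℓ Λ : ℝ} (hℓ : 0 < ℓ) (hΛ : 0 ≤ Λ) {Q d v : ℝ → ℝ}
    (hd : IntervalIntegrable d volume 0 ℓ)
    (hQ : ∀ a ∈ Icc 0 ℓ, Q a = Q 0 + ∫ b in (0 : ℝ)..a, d b) (hQℓ : Q ℓ = Q 0)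
    (hv : ∀ a b, |v a - v b| ≤ Λ * |a - b|) (hvℓ : v ℓ = v 0) :
    |∫ a in (0 : ℝ)..ℓ, Q a * d a * v a| ≤ Λ / 2 * ∫ a in (0 : ℝ)..ℓ, Q a ^ 2 := by
  have hlip : LipschitzWith Λ.toNNReal v := LipschitzWith.of_dist_le_mul fun a b => by
    rw [Real.dist_eq, Real.dist_eq, Real.coe_toNNReal _ hΛ]; exact hv a b
  have hvac : AbsolutelyContinuousOnInterval v 0 ℓ :=
    hlip.lipschitzOnWith.absolutelyContinuousOnInterval
  have hvi := hvac.intervalIntegrable_deriv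
  have hvF : ∀ a ∈ uIcc 0 ℓ, v a = v 0 + ∫ b in (0 : ℝ)..a, deriv v b := by
    intro a ha
    rw [(hvac.mono (uIcc_subset_uIcc (by simp) ha)).integral_deriv_eq_sub]
    ring
  have hvd : ∀ a, |deriv v a| ≤ Λ := fun a => by
    have := norm_deriv_le_of_lipschitz (x₀ := a) hlip
    rwa [Real.coe_toNNReal _ hΛ] at this
  have hQ' : ∀ a ∈ uIcc 0 ℓ, Q a = Q 0 + ∫ b in (0 : ℝ)..a, d b := by rwa [uIcc_of_le hℓ.le]
  have hQc : ContinuousOn Q (uIcc 0 ℓ) :=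
    (continuousOn_const.add (continuousOn_primitive_interval' hd left_mem_uIcc)).congr hQ'
  have hW : ContDiff ℝ 1 (fun y : ℝ × ℝ => y.1 ^ 2 * y.2) := by fun_prop
  have hfd : ∀ y w : ℝ × ℝ, fderiv ℝ (fun y : ℝ × ℝ => y.1 ^ 2 * y.2) y w
      = 2 * (y.1 * w.1 * y.2) + y.1 ^ 2 * w.2 := by
    intro y w
    have h1 : HasFDerivAt (fun y : ℝ × ℝ => y.1 ^ 2) _ y := (hasFDerivAt_fst (𝕜 := ℝ)).pow 2
    have h3 : fderiv ℝ (fun y : ℝ × ℝ => y.1 ^ 2 * y.2) y = _ := (h1.mul hasFDerivAt_snd).fderiv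
    rw [h3]
    simp
    ring
  obtain ⟨k1, k2⟩ := integral_fderiv_comp hW hd hvi hQ' hvF
  simp only [hfd, hQℓ, hvℓ, sub_self] at k1 k2
  have hQ2 : IntervalIntegrable (fun a => Q a ^ 2) volume 0 ℓ := (hQc.pow 2).intervalIntegrable
  have hQv : IntervalIntegrable (fun a => Q a ^ 2 * deriv v a) volume 0 ℓ :=
    hvi.continuousOn_mul (hQc.pow 2)
  have k3 : ∫ a in (0 : ℝ)..ℓ, Q a * d a * v a = -(1 / 2) * ∫ a in (0 : ℝ)..ℓ, Q a ^ 2 * deriv v a := by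
    have h1 : IntervalIntegrable (fun a => 2 * (Q a * d a * v a)) volume 0 ℓ := by
      simpa using k1.sub hQv
    rw [integral_add h1 hQv, intervalIntegral.integral_const_mul] at k2
    linarith
  have k4 : |∫ a in (0 : ℝ)..ℓ, Q a ^ 2 * deriv v a| ≤ ∫ a in (0 : ℝ)..ℓ, Λ * Q a ^ 2 := by
    rw [← Real.norm_eq_abs]
    refine norm_integral_le_of_norm_le hℓ.le (Eventually.of_forall fun a _ => ?_) (hQ2.const_mul _)
    rw [Real.norm_eq_abs, abs_mul, abs_of_nonneg (sq_nonneg _), mul_comm]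
    exact mul_le_mul_of_nonneg_right (hvd a) (sq_nonneg _)
  rw [k3, abs_mul, abs_neg, abs_of_nonneg (by norm_num : (0 : ℝ) ≤ 1 / 2)]
  rw [intervalIntegral.integral_const_mul] at k4
  linarith

/-- An integrable solution of `∂ₜd + ∂ₐ(d v) = 0` on the circle of length `ℓ` with vanishing initial
value vanishes. The primitive `F(t, a) = -∫₀ᵗ d v` has spatial derivative `d`, hence solves
`∂ₜF + v ∂ₐF = 0`, and Gronwall's lemma applies to `∫ F²`. -/
theorem ae_eq_zero_of_continuityEquation {ℓ T K : ℝ} (hℓ : 0 < ℓ) {v d : ℝ → ℝ → ℝ} {L : ℝ → ℝ}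
    (hvm : Measurable (Function.uncurry v)) (hL : Integrable L)
    (hvb : ∀ s a, |v s a| ≤ L s) (hvl : ∀ s a b, |v s a - v s b| ≤ L s * |a - b|)
    (hvℓ : ∀ s, v s ℓ = v s 0)
    (hdm : Measurable (Function.uncurry d))
    (hdi : ∀ t ∈ Icc 0 T, IntervalIntegrable (d t) volume 0 ℓ)
    (hdK : ∀ t ∈ Icc 0 T, ∫ a in (0 : ℝ)..ℓ, |d t a| ≤ K)
    (heq : ∀ φ : ℝ → ℝ, ContDiff ℝ 1 φ → Function.Periodic φ ℓ → ∀ t ∈ Icc 0 T,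
      ∫ a in (0 : ℝ)..ℓ, d t a * φ a
        = ∫ s in (0 : ℝ)..t, ∫ a in (0 : ℝ)..ℓ, d s a * (v s a * deriv φ a)) :
    ∀ t ∈ Icc 0 T, ∀ᵐ a ∂(volume.restrict (Ioc 0 ℓ)), d t a = 0 := by
  intro t₀ ht₀
  have hL0 : ∀ s, 0 ≤ L s := fun s => (abs_nonneg _).trans (hvb s 0)
  set j : ℝ → ℝ → ℝ := fun s a => -(d s a * v s a) with hj
  have hjm : Measurable (Function.uncurry j) := (hdm.mul hvm).neg
  have hvs : ∀ s, Continuous (v s) := fun s =>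
    (LipschitzWith.of_dist_le_mul (K := (L s).toNNReal) fun a b => by
      rw [Real.dist_eq, Real.dist_eq, Real.coe_toNNReal _ (hL0 s)]; exact hvl s a b).continuous
  have hjs : ∀ s ∈ Icc 0 T, IntervalIntegrable (j s) volume 0 ℓ := fun s hs =>
    ((hdi s hs).mul_continuousOn (hvs s).continuousOn).neg
  -- `j` is integrable on `(0, T) × (0, ℓ)`
  have hjint : Integrable (Function.uncurry j)
      ((volume.restrict (Ioc 0 T)).prod (volume.restrict (Ioc 0 ℓ))) := by
    rw [integrable_prod_iff hjm.aestronglyMeasurable]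
    constructor
    · rw [ae_restrict_iff' measurableSet_Ioc]
      refine Eventually.of_forall fun s hs => ?_
      exact (intervalIntegrable_iff_integrableOn_Ioc_of_le hℓ.le).1 (hjs s (Ioc_subset_Icc_self hs))
    · refine ((hL.mul_const K).integrableOn (s := Ioc 0 T)).mono' ?_ ?_
      · exact hjm.norm.stronglyMeasurable.integral_prod_right.aestronglyMeasurable
      · rw [ae_restrict_iff' measurableSet_Ioc]
        refine Eventually.of_forall fun s hs => ?_
        have hs' := Ioc_subset_Icc_self hs
        rw [Real.norm_of_nonneg (MeasureTheory.integral_nonneg fun _ => norm_nonneg _)]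
        calc ∫ a in Ioc 0 ℓ, ‖Function.uncurry j (s, a)‖
            ≤ ∫ a in Ioc 0 ℓ, L s * |d s a| := by
              refine setIntegral_mono ?_ ?_ fun a => ?_
              · exact ((intervalIntegrable_iff_integrableOn_Ioc_of_le hℓ.le).1 (hjs s hs')).norm
              · exact (((intervalIntegrable_iff_integrableOn_Ioc_of_le hℓ.le).1
                  (hdi s hs')).abs).const_mul _
              · simp only [Function.uncurry, hj, Real.norm_eq_abs, abs_neg, abs_mul]
                rw [mul_comm]
                exact mul_le_mul_of_nonneg_right (hvb s a) (abs_nonneg _)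
          _ = L s * ∫ a in (0 : ℝ)..ℓ, |d s a| := by
              rw [MeasureTheory.integral_const_mul, integral_of_le hℓ.le]
          _ ≤ L s * K := mul_le_mul_of_nonneg_left (hdK s hs') (hL0 s)
  have hjt : ∀ t ∈ Icc 0 T, Integrable (Function.uncurry j)
      ((volume.restrict (Ioc 0 t)).prod (volume.restrict (Ioc 0 ℓ))) := fun t ht =>
    hjint.mono_measure <| by
      rw [Measure.prod_restrict, Measure.prod_restrict]
      exact Measure.restrict_mono (prod_mono_left (Ioc_subset_Ioc_right ht.2)) le_rfl
  set F : ℝ → ℝ → ℝ := fun t a => ∫ s in (0 : ℝ)..max t 0, j s a with hF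
  have hFm : Measurable (Function.uncurry F) := measurable_integral_zero_max hjm
  have hFt : ∀ t, 0 ≤ t → ∀ a, F t a = ∫ s in Ioc 0 t, j s a := fun t ht a => by
    simp only [hF, max_eq_left ht, integral_of_le ht]
  -- the total mass of `j` and the bound for `F`
  set J : ℝ := ∫ a in Ioc 0 ℓ, ∫ s in Ioc 0 T, ‖j s a‖ with hJ
  have hJae : ∀ t ∈ Icc 0 T, ∀ᵐ a ∂(volume.restrict (Ioc 0 ℓ)),
      |F t a| ≤ ∫ s in Ioc 0 T, ‖j s a‖ := by
    intro t ht
    filter_upwards [hjint.prod_left_ae] with a ha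
    rw [hFt t ht.1, ← Real.norm_eq_abs]
    refine (MeasureTheory.norm_integral_le_integral_norm _).trans ?_
    exact setIntegral_mono_set ha.norm (Eventually.of_forall fun _ => norm_nonneg _)
      (Ioc_subset_Ioc_right ht.2).eventuallyLE
  have hFi : ∀ t ∈ Icc 0 T, IntegrableOn (F t) (Ioc 0 ℓ) := fun t ht =>
    hjint.integral_norm_prod_right.mono' hFm.of_uncurry_left.aestronglyMeasurable (hJae t ht)
  have hFJ : ∀ t ∈ Icc 0 T, ∫ a in Ioc 0 ℓ, |F t a| ≤ J := fun t ht =>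
    integral_mono_ae (hFi t ht).abs hjint.integral_norm_prod_right (hJae t ht)
  -- `F t` is a primitive of `d t`, up to a constant
  have hprim : ∀ t ∈ Icc 0 T, ∃ c, (∀ᵐ a ∂(volume.restrict (Ioc 0 ℓ)),
      F t a = c + ∫ b in (0 : ℝ)..a, d t b) ∧ ∫ b in (0 : ℝ)..ℓ, d t b = 0 := by
    intro t ht
    have hend : ∫ b in (0 : ℝ)..ℓ, d t b = 0 := by
      simpa using heq (fun _ => 1) contDiff_const (fun _ => rfl) t ht
    set P : ℝ → ℝ := fun a => ∫ b in (0 : ℝ)..a, d t b with hP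
    have hFii : IntervalIntegrable (F t) volume 0 ℓ :=
      (intervalIntegrable_iff_integrableOn_Ioc_of_le hℓ.le).2 (hFi t ht)
    have hPc : ContinuousOn P (uIcc 0 ℓ) := continuousOn_primitive_interval' (hdi t ht) left_mem_uIcc
    obtain ⟨c, hc⟩ := exists_ae_eq_const_of_integral_mul_deriv_eq_zero hℓ
      (hFii.sub hPc.intervalIntegrable) fun φ hφ hφp => by
        have hφ' : Continuous (deriv φ) := hφ.continuous_deriv_one
        -- Fubini
        have hFφ : ∫ a in (0 : ℝ)..ℓ, F t a * deriv φ a = -∫ a in (0 : ℝ)..ℓ, d t a * φ a := by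
          obtain ⟨B, hB⟩ := isCompact_Icc.exists_bound_of_continuousOn
            (s := Icc 0 ℓ) hφ'.continuousOn
          have hint : Integrable (Function.uncurry fun s a => j s a * deriv φ a)
              ((volume.restrict (Ioc 0 t)).prod (volume.restrict (Ioc 0 ℓ))) := by
            refine (hjt t ht).mul_bdd (c := B)
              (hφ'.comp continuous_snd).aestronglyMeasurable ?_
            have : ∀ᵐ p ∂((volume.restrict (Ioc 0 t)).prod (volume.restrict (Ioc (0 : ℝ) ℓ))),
                p.2 ∈ Ioc 0 ℓ := Measure.quasiMeasurePreserving_snd.ae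
                  (ae_restrict_mem measurableSet_Ioc)
            filter_upwards [this] with p hp using hB _ (Ioc_subset_Icc_self hp)
          have hsw := integral_integral_swap hint
          rw [heq φ hφ hφp t ht, integral_of_le hℓ.le, integral_of_le ht.1,
            ← MeasureTheory.integral_neg]
          simp only [hFt t ht.1, ← MeasureTheory.integral_mul_const]
          rw [← hsw]
          refine MeasureTheory.integral_congr_ae (Eventually.of_forall fun s => ?_)
          simp only
          rw [integral_of_le hℓ.le, ← MeasureTheory.integral_neg]
          refine MeasureTheory.integral_congr_ae (Eventually.of_forall fun a => ?_)
          simp only [hj]; ring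
        have hPφ : ∫ a in (0 : ℝ)..ℓ, P a * deriv φ a = -∫ a in (0 : ℝ)..ℓ, d t a * φ a := by
          have hW : ContDiff ℝ 1 (fun y : ℝ × ℝ => y.1 * y.2) := by fun_prop
          have hfd : ∀ y w : ℝ × ℝ, fderiv ℝ (fun y : ℝ × ℝ => y.1 * y.2) y w
              = y.1 * w.2 + w.1 * y.2 := by
            intro y w
            have h3 : fderiv ℝ (fun y : ℝ × ℝ => y.1 * y.2) y = _ :=
              ((hasFDerivAt_fst (𝕜 := ℝ)).mul hasFDerivAt_snd).fderiv
            rw [h3]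
            simp
            ring
          have hφi : IntervalIntegrable (deriv φ) volume 0 ℓ := hφ'.intervalIntegrable _ _
          have k := (integral_fderiv_comp hW (hdi t ht) hφi (p := P) (q := φ)
            (fun a _ => by simp [hP]) (fun a _ => by
              rw [integral_deriv_eq_sub (fun x _ => hφ.differentiable (by decide) x)
                (hφ'.intervalIntegrable _ _)]
              ring)).2
          have hP0 : P 0 = 0 := by simp [hP]
          have hPℓ : P ℓ = 0 := hend
          simp only [hfd, hP0, hPℓ, zero_mul, sub_zero] at k
          rw [integral_add (hφi.continuousOn_mul hPc)
            ((hdi t ht).mul_continuousOn hφ.continuous.continuousOn)] at k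
          linarith
        have e1 : IntervalIntegrable (fun a => F t a * deriv φ a) volume 0 ℓ :=
          hFii.mul_continuousOn hφ'.continuousOn
        have e2 : IntervalIntegrable (fun a => P a * deriv φ a) volume 0 ℓ :=
          hPc.intervalIntegrable.mul_continuousOn hφ'.continuousOn
        simp only [sub_mul]
        rw [integral_sub e1 e2, hFφ, hPφ, sub_self]
    refine ⟨c, ?_, hend⟩
    filter_upwards [hc] with a ha
    linarith
  have hPK : ∀ t ∈ Icc 0 T, ∀ a ∈ Ioc 0 ℓ, |∫ b in (0 : ℝ)..a, d t b| ≤ K := by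
    intro t ht a ha
    rw [← Real.norm_eq_abs]
    refine (intervalIntegral.norm_integral_le_integral_norm ha.1.le).trans (le_trans ?_ (hdK t ht))
    exact integral_mono_interval le_rfl ha.1.le ha.2 (Eventually.of_forall fun _ => abs_nonneg _)
      (hdi t ht).abs
  set M : ℝ := J / ℓ + K + K with hM
  have hFM : ∀ t ∈ Icc 0 T, ∀ᵐ a ∂(volume.restrict (Ioc 0 ℓ)), |F t a| ≤ M := by
    intro t ht
    obtain ⟨c, hc, -⟩ := hprim t ht
    have hc' : |c| * ℓ ≤ J + K * ℓ := by
      have h1 : ∫ _ in Ioc 0 ℓ, |c| ≤ ∫ a in Ioc 0 ℓ, (|F t a| + K) := by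
        refine integral_mono_ae (by simp) ((hFi t ht).abs.add (by simp)) ?_
        filter_upwards [hc, ae_restrict_mem measurableSet_Ioc] with a ha ha'
        have : c = F t a - ∫ b in (0 : ℝ)..a, d t b := by linarith
        calc |c| = |F t a - ∫ b in (0 : ℝ)..a, d t b| := by rw [← this]
          _ ≤ |F t a| + |∫ b in (0 : ℝ)..a, d t b| := abs_sub _ _
          _ ≤ |F t a| + K := by gcongr; exact hPK t ht a ha'
      rw [MeasureTheory.integral_add (hFi t ht).abs (by simp)] at h1
      simp [hℓ.le] at h1
      have h2 := hFJ t ht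
      linarith
    have hc'' : |c| ≤ J / ℓ + K := by
      rw [← mul_le_mul_iff_left₀ hℓ, add_mul, div_mul_cancel₀ _ hℓ.ne']
      exact hc'
    filter_upwards [hc, ae_restrict_mem measurableSet_Ioc] with a ha ha'
    rw [ha]
    exact (abs_add_le _ _).trans (add_le_add hc'' (hPK t ht a ha'))
  have hFj : ∀ t ∈ Icc 0 T, Integrable (Function.uncurry fun s a => F s a * j s a)
      ((volume.restrict (Ioc 0 t)).prod (volume.restrict (Ioc 0 ℓ))) := by
    intro t ht
    refine (hjt t ht).bdd_mul (c := M) hFm.aestronglyMeasurable ?_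
    refine (Measure.ae_prod_iff_ae_ae (p := fun z => ‖Function.uncurry F z‖ ≤ M)
      (measurableSet_le hFm.norm measurable_const)).2 ?_
    rw [ae_restrict_iff' measurableSet_Ioc]
    exact Eventually.of_forall fun s hs => hFM s ⟨hs.1.le, hs.2.trans ht.2⟩
  -- energy estimate
  have henergy : ∀ t ∈ Icc 0 T, ∫ a in Ioc 0 ℓ, F t a ^ 2
      ≤ ∫ s in (0 : ℝ)..t, L s * ∫ a in Ioc 0 ℓ, F s a ^ 2 := by
    intro t ht
    have h1 : ∀ᵐ a ∂(volume.restrict (Ioc 0 ℓ)),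
        F t a ^ 2 = 2 * ∫ s in Ioc 0 t, F s a * j s a := by
      filter_upwards [(hjt t ht).prod_left_ae] with a ha
      have k := integral_mul_self_primitive (q := fun s => F s a) (g := fun s => j s a)
        ((intervalIntegrable_iff_integrableOn_Ioc_of_le ht.1).2 ha) (fun s hs => by
          rw [uIcc_of_le ht.1] at hs
          simp [hF, max_eq_left hs.1])
      have hF0 : F 0 a = 0 := by simp [hF]
      simp only [hF0, integral_of_le ht.1] at k
      rw [k]; ring
    have h2 : ∫ a in Ioc 0 ℓ, F t a ^ 2
        = ∫ s in (0 : ℝ)..t, 2 * ∫ a in Ioc 0 ℓ, F s a * j s a := by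
      rw [MeasureTheory.integral_congr_ae h1, MeasureTheory.integral_const_mul,
        ← integral_integral_swap (hFj t ht), intervalIntegral.integral_const_mul,
        integral_of_le ht.1]
    have h3 : ∀ s ∈ Ioc 0 t, |2 * ∫ a in Ioc 0 ℓ, F s a * j s a|
        ≤ L s * ∫ a in Ioc 0 ℓ, F s a ^ 2 := by
      intro s hs
      have hs' : s ∈ Icc 0 T := ⟨hs.1.le, hs.2.trans ht.2⟩
      obtain ⟨c, hc, hend⟩ := hprim s hs'
      set Q : ℝ → ℝ := fun a => c + ∫ b in (0 : ℝ)..a, d s b with hQ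
      have e1 : ∫ a in Ioc 0 ℓ, F s a * j s a = -∫ a in (0 : ℝ)..ℓ, Q a * d s a * v s a := by
        rw [integral_of_le hℓ.le, ← MeasureTheory.integral_neg]
        refine MeasureTheory.integral_congr_ae ?_
        filter_upwards [hc] with a ha
        rw [ha]
        simp only [hj, hQ]; ring
      have e2 : ∫ a in Ioc 0 ℓ, F s a ^ 2 = ∫ a in (0 : ℝ)..ℓ, Q a ^ 2 := by
        rw [integral_of_le hℓ.le]
        refine MeasureTheory.integral_congr_ae ?_
        filter_upwards [hc] with a ha
        rw [ha]
      have e3 := abs_integral_primitive_mul_le hℓ (hL0 s) (Q := Q) (hdi s hs') (by simp [hQ])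
        (by simp [hQ, hend]) (hvl s) (hvℓ s)
      rw [e1, e2, abs_mul, abs_neg, abs_of_pos (zero_lt_two (α := ℝ))]
      linarith
    have hsqm : Measurable fun s => ∫ a in Ioc 0 ℓ, F s a ^ 2 :=
      (hFm.pow_const 2).stronglyMeasurable.integral_prod_right.measurable
    rw [h2]
    refine (le_abs_self _).trans ?_
    rw [← Real.norm_eq_abs]
    refine norm_integral_le_of_norm_le ht.1 (Eventually.of_forall fun s hs => h3 s hs) ?_
    rw [intervalIntegrable_iff_integrableOn_Ioc_of_le ht.1]
    refine (hL.integrableOn).mul_bdd (c := ∫ _ in Ioc 0 ℓ, M ^ 2) hsqm.aestronglyMeasurable ?_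
    rw [ae_restrict_iff' measurableSet_Ioc]
    refine Eventually.of_forall fun s hs => ?_
    rw [Real.norm_of_nonneg (MeasureTheory.integral_nonneg fun _ => sq_nonneg _)]
    refine integral_mono_of_nonneg (Eventually.of_forall fun _ => sq_nonneg _) (by simp) ?_
    filter_upwards [hFM s ⟨hs.1.le, hs.2.trans ht.2⟩] with a ha
    exact sq_le_sq' (by linarith [neg_abs_le (F s a)]) ((le_abs_self _).trans ha)
  have hzero := eq_zero_of_le_integral hL hL0 (T := T) (M := ∫ _ in Ioc 0 ℓ, M ^ 2)
    (e := fun t => ∫ a in Ioc 0 ℓ, F t a ^ 2)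
    (fun t _ => MeasureTheory.integral_nonneg fun _ => sq_nonneg _) (fun t ht => by
      refine integral_mono_of_nonneg (Eventually.of_forall fun _ => sq_nonneg _) (by simp) ?_
      filter_upwards [hFM t ht] with a ha
      exact sq_le_sq' (by linarith [neg_abs_le (F t a)]) ((le_abs_self _).trans ha)) henergy t₀ ht₀
  -- hence the primitive of `d t₀` is constant
  have hF2i : IntegrableOn (fun a => F t₀ a ^ 2) (Ioc 0 ℓ) := by
    refine Integrable.mono' (g := fun _ => M ^ 2) (by simp)
      (hFm.of_uncurry_left.pow_const 2).aestronglyMeasurable ?_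
    filter_upwards [hFM t₀ ht₀] with a ha
    rw [Real.norm_of_nonneg (sq_nonneg _)]
    exact sq_le_sq' (by linarith [neg_abs_le (F t₀ a)]) ((le_abs_self _).trans ha)
  have hF0 := (integral_eq_zero_iff_of_nonneg (fun _ => sq_nonneg _) hF2i).1 hzero
  obtain ⟨c, hc, -⟩ := hprim t₀ ht₀
  have hPc : ContinuousOn (fun a => ∫ b in (0 : ℝ)..a, d t₀ b) (uIcc 0 ℓ) :=
    continuousOn_primitive_interval' (hdi t₀ ht₀) left_mem_uIcc
  rw [uIcc_of_le hℓ.le] at hPc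
  have hP : EqOn (fun a => ∫ b in (0 : ℝ)..a, d t₀ b) (fun _ => -c) (Ioo 0 ℓ) := by
    refine Measure.eqOn_Ioo_of_ae_eq (μ := volume) ?_ (hPc.mono Ioo_subset_Icc_self) continuousOn_const
    rw [restrict_Ioo_eq_restrict_Ioc]
    filter_upwards [hc, hF0] with a ha ha0
    have : F t₀ a = 0 := by simpa using ha0
    linarith
  rw [← restrict_Ioo_eq_restrict_Ioc, ae_restrict_iff' measurableSet_Ioo]
  filter_upwards [(hdi t₀ ht₀).ae_hasDerivAt_integral] with a ha haI
  have h1 := ha (by rw [uIcc_of_le hℓ.le]; exact Ioo_subset_Icc_self haI) 0 left_mem_uIcc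
  have h2 : HasDerivAt (fun a => ∫ b in (0 : ℝ)..a, d t₀ b) 0 a :=
    (hasDerivAt_const a (-c)).congr_of_eventuallyEq (hP.eventuallyEq_of_mem (isOpen_Ioo.mem_nhds haI))
  exact h1.unique h2

/-! ### Transport of measures by flows -/

theorem continuous_prod_torus_iff {f : ℝ × Torus → ℝ} :
    Continuous f ↔ Continuous (fun p : ℝ × ℝ => f (p.1, (p.2 : Torus))) :=
  ((IsOpenQuotientMap.id (X := ℝ)).prodMap
    (QuotientAddGroup.isOpenQuotientMap_mk
      (N := AddSubgroup.zmultiples (2 * Real.pi)))).isQuotientMap.continuous_iff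

section TestFunction

variable {w : ℝ → Torus → ℝ}

theorem continuous_uncurry_of_contDiff
    (hw : ContDiff ℝ 1 (fun p : ℝ × ℝ => w p.1 (p.2 : Torus))) :
    Continuous (Function.uncurry w) :=
  continuous_prod_torus_iff.2 hw.continuous

theorem continuous_time_deriv (hw : ContDiff ℝ 1 (fun p : ℝ × ℝ => w p.1 (p.2 : Torus))) :
    Continuous (fun p : ℝ × Torus => deriv (fun r : ℝ => w r p.2) p.1) := by
  rw [continuous_prod_torus_iff]
  have h : (fun p : ℝ × ℝ => deriv (fun r : ℝ => w r (p.2 : Torus)) p.1)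
      = fun p : ℝ × ℝ => fderiv ℝ (fun p : ℝ × ℝ => w p.1 (p.2 : Torus)) p (1, 0) := by
    funext p
    exact (((hw.differentiable (by decide) p).hasFDerivAt).comp_hasDerivAt
      (f := fun r : ℝ => (r, p.2)) p.1
      ((hasDerivAt_id p.1).prodMk (hasDerivAt_const p.1 p.2))).deriv
  show Continuous (fun p : ℝ × ℝ => deriv (fun r : ℝ => w r (p.2 : Torus)) p.1)
  rw [h]
  exact (hw.continuous_fderiv (by decide)).clm_apply continuous_const

theorem continuous_space_deriv (hw : ContDiff ℝ 1 (fun p : ℝ × ℝ => w p.1 (p.2 : Torus))) :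
    Continuous (fun p : ℝ × Torus => torusDeriv (w p.1) p.2) := by
  rw [continuous_prod_torus_iff]
  have h : (fun p : ℝ × ℝ => torusDeriv (w p.1) (p.2 : Torus))
      = fun p : ℝ × ℝ => fderiv ℝ (fun p : ℝ × ℝ => w p.1 (p.2 : Torus)) p (0, 1) := by
    funext p
    rw [torusDeriv_coe]
    exact (((hw.differentiable (by decide) p).hasFDerivAt).comp_hasDerivAt
      (f := fun c : ℝ => (p.1, c)) p.2
      ((hasDerivAt_const p.2 p.1).prodMk (hasDerivAt_id p.2))).deriv
  show Continuous (fun p : ℝ × ℝ => torusDeriv (w p.1) (p.2 : Torus))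
  rw [h]
  exact (hw.continuous_fderiv (by decide)).clm_apply continuous_const

theorem exists_bound_on_strip {f : ℝ × Torus → ℝ} (hf : Continuous f) (t : ℝ) :
    ∃ B, 0 ≤ B ∧ ∀ s ∈ Icc 0 t, ∀ u, |f (s, u)| ≤ B := by
  obtain ⟨B, hB⟩ := ((isCompact_Icc (a := (0 : ℝ)) (b := t)).prod
    (isCompact_univ (X := Torus))).exists_bound_of_continuousOn hf.continuousOn
  exact ⟨max B 0, le_max_right _ _, fun s hs u => (hB (s, u) ⟨hs, trivial⟩).trans (le_max_left _ _)⟩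

end TestFunction

section Transport

variable {V : ℝ → Torus → ℝ} {L : ℝ → ℝ} {ξ : ℝ → Torus → ℝ}

theorem IsFlow.exists_antilipschitz (h : IsFlow V ξ) (hV : IsLipField V L) (t : ℝ) :
    ∃ K : NNReal, AntilipschitzWith K (position ξ t) := by
  have : position ξ t = position ξ (max t 0) := by
    funext u
    simp only [position, h.eq_integral t u, h.eq_integral (max t 0) u, max_assoc, max_self]
  rw [this]
  exact h.antilipschitz hV (le_max_right _ _)

/-- Weak form of the continuity equation for a measure transported by a flow. -/
theorem IsFlow.integral_transport (h : IsFlow V ξ) (hV : IsLipField V L) (μ : Measure Torus)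
    [IsFiniteMeasure μ] {w : ℝ → Torus → ℝ}
    (hw : ContDiff ℝ 1 (fun p : ℝ × ℝ => w p.1 (p.2 : Torus))) {t : ℝ} (ht : 0 ≤ t) :
    ∫ s in (0 : ℝ)..t, ∫ u, (deriv (fun r : ℝ => w r (position ξ s u)) s
        + V s (position ξ s u) * torusDeriv (w s) (position ξ s u)) ∂μ
      = (∫ u, w t (position ξ t u) ∂μ) - ∫ u, w 0 u ∂μ := by
  obtain ⟨B, hB0, hB⟩ := exists_bound_on_strip (continuous_time_deriv hw) t
  obtain ⟨B', hB0', hB'⟩ := exists_bound_on_strip (continuous_space_deriv hw) t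
  have hwc := continuous_uncurry_of_contDiff hw
  have hpos := measurable_position h.measurable
  have hpair : Measurable fun p : ℝ × Torus => (p.1, position ξ p.1 p.2) :=
    measurable_fst.prodMk hpos
  have hm : Measurable (Function.uncurry fun s u => deriv (fun r : ℝ => w r (position ξ s u)) s
        + V s (position ξ s u) * torusDeriv (w s) (position ξ s u)) :=
    ((continuous_time_deriv hw).measurable.comp hpair).add
      ((hV.measurable.comp hpair).mul ((continuous_space_deriv hw).measurable.comp hpair))
  have hint : Integrable (Function.uncurry fun s u => deriv (fun r : ℝ => w r (position ξ s u)) s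
        + V s (position ξ s u) * torusDeriv (w s) (position ξ s u))
      ((volume.restrict (Ioc 0 t)).prod μ) := by
    have hdom : Integrable (fun p : ℝ × Torus => B + L p.1 * B')
        ((volume.restrict (Ioc 0 t)).prod μ) :=
      (integrable_const B).add (((hV.integrable.restrict (s := Ioc 0 t)).mul_const B').comp_fst μ)
    refine hdom.mono' hm.aestronglyMeasurable ?_
    have hmem : ∀ᵐ p ∂((volume.restrict (Ioc 0 t)).prod μ), p.1 ∈ Ioc 0 t :=
      Measure.quasiMeasurePreserving_fst.ae (ae_restrict_mem measurableSet_Ioc)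
    filter_upwards [hmem] with p hp
    have hp' := Ioc_subset_Icc_self hp
    refine (norm_add_le _ _).trans (add_le_add (hB _ hp' _) ?_)
    rw [norm_mul]
    exact mul_le_mul (hV.bound _ _) (hB' p.1 hp' (position ξ p.1 p.2)) (norm_nonneg _)
      (hV.nonneg _)
  rw [integral_of_le ht, integral_integral_swap hint]
  have h1 : ∀ u, ∫ s in Ioc 0 t, (deriv (fun r : ℝ => w r (position ξ s u)) s
        + V s (position ξ s u) * torusDeriv (w s) (position ξ s u))
      = w t (position ξ t u) - w 0 u := fun u => by
    rw [← integral_of_le ht]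
    exact h.integral_deriv_position hV hw ht u
  simp only [h1]
  have hbw : ∀ s ∈ Icc 0 t, Integrable (fun u => w s (position ξ s u)) μ := by
    intro s hs
    obtain ⟨B'', -, hB''⟩ := exists_bound_on_strip hwc t
    exact Integrable.of_bound ((hwc.measurable.comp hpair).of_uncurry_left
      (f := fun s u => w s (position ξ s u)) (x := s)).aestronglyMeasurable B''
      (Eventually.of_forall fun u => hB'' s hs _)
  have h2 := hbw 0 ⟨le_rfl, ht⟩
  simp only [h.position_zero] at h2
  exact MeasureTheory.integral_sub (hbw t ⟨ht, le_rfl⟩) h2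

/-- Superposition: an integrable weak solution of the linear continuity equation is the density of
the initial measure transported by the flow. -/
theorem IsFlow.map_eq_withDensity_of_continuityEquation (h : IsFlow V ξ) (hV : IsLipField V L)
    {μ : Measure Torus} [IsFiniteMeasure μ] (hμ : μ ≪ volume) {T K : ℝ} {σ : ℝ → Torus → ℝ}
    (hσm : Measurable (Function.uncurry σ)) (hσi : ∀ t ∈ Icc 0 T, Integrable (σ t))
    (hσK : ∀ t ∈ Icc 0 T, ∫ u, |σ t u| ≤ K)
    (heq : ∀ φ : Torus → ℝ, ContDiff ℝ 1 (fun a : ℝ => φ (a : Torus)) → ∀ t ∈ Icc 0 T,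
      ∫ u, σ t u * φ u = (∫ u, φ u ∂μ) + ∫ s in (0 : ℝ)..t, ∫ u, σ s u * (V s u * torusDeriv φ u)) :
    ∀ t ∈ Icc 0 T, (∀ᵐ u, 0 ≤ σ t u) ∧
      μ.map (position ξ t) = volume.withDensity (fun u => ENNReal.ofReal (σ t u)) := by
  have hpos := measurable_position h.measurable
  obtain ⟨p, hpm, hp0, hp⟩ := exists_measurable_density (μ := Kernel.const ℝ μ)
    (fun s => by rwa [Kernel.const_apply]) hpos (h.exists_antilipschitz hV)
  simp only [Kernel.const_apply] at hp
  have hpt : ∀ t, Measurable (p t) := fun t => hpm.of_uncurry_left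
  have hpf : ∀ t, ∀ f : Torus → ℝ, Measurable f →
      ∫ u, p t u * f u = ∫ u, f (position ξ t u) ∂μ := by
    intro t f hf
    rw [← integral_withDensity_ofReal (hpt t) (Eventually.of_forall (hp0 t)), ← hp t,
      integral_map hpos.of_uncurry_left.aemeasurable hf.aestronglyMeasurable]
  have hpmass : ∀ t, ∫⁻ u, ENNReal.ofReal (p t u) = μ univ := by
    intro t
    have := congrArg (fun m => m univ) (hp t)
    rw [withDensity_apply _ MeasurableSet.univ, Measure.restrict_univ,
      Measure.map_apply hpos.of_uncurry_left MeasurableSet.univ] at this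
    exact this.symm
  have hpi : ∀ t, Integrable (p t) := fun t => by
    refine ⟨(hpt t).aestronglyMeasurable, ?_⟩
    rw [hasFiniteIntegral_iff_ofReal (Eventually.of_forall (hp0 t)), hpmass]
    exact measure_lt_top _ _
  have hpI : ∀ t, ∫ u, |p t u| = μ.real univ := fun t => by
    have := hpf t (fun _ => 1) measurable_const
    simpa [abs_of_nonneg (hp0 t _)] using this
  suffices H : ∀ t ∈ Icc 0 T, ∀ᵐ u, σ t u - p t u = 0 by
    intro t ht
    refine ⟨?_, ?_⟩
    · filter_upwards [H t ht] with u hu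
      rw [sub_eq_zero.1 hu]
      exact hp0 t u
    · rw [hp t]
      refine withDensity_congr_ae ?_
      filter_upwards [H t ht] with u hu
      rw [sub_eq_zero.1 hu]
  -- pass to the interval `(0, 2π)`
  have hℓ : (0 : ℝ) < 2 * Real.pi := Real.two_pi_pos
  have hmp := AddCircle.measurePreserving_mk (2 * Real.pi) 0
  rw [zero_add] at hmp
  have hIconv : ∀ f : Torus → ℝ, ∫ a in (0 : ℝ)..2 * Real.pi, f (a : Torus) = ∫ u, f u := fun f => by
    have := AddCircle.intervalIntegral_preimage (2 * Real.pi) 0 f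
    rwa [zero_add] at this
  have hII : ∀ f : Torus → ℝ, Integrable f →
      IntervalIntegrable (fun a : ℝ => f (a : Torus)) volume 0 (2 * Real.pi) := fun f hf =>
    (intervalIntegrable_iff_integrableOn_Ioc_of_le hℓ.le).2 (hmp.integrable_comp_of_integrable hf)
  have hcoe : Measurable fun q : ℝ × ℝ => (q.1, (q.2 : Torus)) :=
    measurable_fst.prodMk (AddCircle.measurable_mk'.comp measurable_snd)
  have hdist : ∀ a b : ℝ, dist (a : Torus) (b : Torus) ≤ |a - b| := fun a b => by
    simpa using dist_add_coe_le 0 a b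
  have key := ae_eq_zero_of_continuityEquation (T := T) (K := K + μ.real univ) hℓ
    (v := fun s a => V s (a : Torus)) (d := fun s a => σ s (a : Torus) - p s (a : Torus)) (L := L)
    (hV.measurable.comp hcoe) hV.integrable (fun s a => hV.bound s _)
    (fun s a b => (hV.lipschitz s _ _).trans
      (mul_le_mul_of_nonneg_left (hdist a b) (hV.nonneg s)))
    (fun s => by simp only [AddCircle.coe_period, AddCircle.coe_zero])
    ((hσm.comp hcoe).sub (hpm.comp hcoe))
    (fun t ht => hII (fun u => σ t u - p t u) ((hσi t ht).sub (hpi t)))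
    (fun t ht => by
      rw [hIconv (fun u => |σ t u - p t u|)]
      calc ∫ u, |σ t u - p t u| ≤ ∫ u, (|σ t u| + |p t u|) :=
            integral_mono ((hσi t ht).sub (hpi t)).abs ((hσi t ht).abs.add (hpi t).abs)
              fun u => abs_sub _ _
        _ ≤ K + μ.real univ := by
            rw [MeasureTheory.integral_add (hσi t ht).abs (hpi t).abs, hpI]
            gcongr
            exact hσK t ht)
    (fun φ hφ hφp t ht => by
      set ψ : Torus → ℝ := hφp.lift with hψ
      have hψφ : ∀ a : ℝ, ψ (a : Torus) = φ a := fun a => rfl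
      have hψ' : ∀ a : ℝ, deriv φ a = torusDeriv ψ (a : Torus) := fun a =>
        (torusDeriv_coe ψ a).symm
      have hψC : ContDiff ℝ 1 (fun a : ℝ => ψ (a : Torus)) := hφ
      have hψw : ContDiff ℝ 1 (fun q : ℝ × ℝ => (fun _ : ℝ => ψ) q.1 (q.2 : Torus)) :=
        hψC.comp contDiff_snd
      have hψc : Continuous ψ := by
        have := (continuous_uncurry_of_contDiff (w := fun _ => ψ) hψw).comp
          (continuous_const (y := (0 : ℝ)) |>.prodMk continuous_id)
        exact this
      have hψdc : Continuous (torusDeriv ψ) := by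
        have := (continuous_space_deriv (w := fun _ => ψ) hψw).comp
          (continuous_const (y := (0 : ℝ)) |>.prodMk continuous_id)
        exact this
      obtain ⟨B, hB⟩ := isCompact_univ.exists_bound_of_continuousOn hψc.continuousOn
      obtain ⟨B', hB'⟩ := isCompact_univ.exists_bound_of_continuousOn hψdc.continuousOn
      have hVs : ∀ s, Measurable (V s) := fun s => hV.measurable.of_uncurry_left
      have hmulψ : ∀ f : Torus → ℝ, Integrable f → Integrable (fun u => f u * ψ u) := fun f hf =>
        hf.mul_bdd (c := B) hψc.aestronglyMeasurable (Eventually.of_forall fun u => hB u trivial)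
      have hmulV : ∀ s, ∀ f : Torus → ℝ, Integrable f →
          Integrable (fun u => f u * (V s u * torusDeriv ψ u)) := fun s f hf =>
        hf.mul_bdd (c := L s * B') ((hVs s).mul hψdc.measurable).aestronglyMeasurable
          (Eventually.of_forall fun u => by
            rw [norm_mul]
            exact mul_le_mul (hV.bound s u) (hB' u trivial) (norm_nonneg _) (hV.nonneg s))
      -- each of the two solutions satisfies the integrated equation
      have e1 := heq ψ hψC t ht
      have e2 := h.integral_transport hV μ (w := fun _ => ψ) hψw ht.1
      simp only [deriv_const, zero_add] at e2
      rw [← hpf t ψ hψc.measurable] at e2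
      have e2' : ∫ s in (0 : ℝ)..t, ∫ u, p s u * (V s u * torusDeriv ψ u)
          = (∫ u, p t u * ψ u) - ∫ u, ψ u ∂μ := by
        rw [← e2]
        exact integral_congr fun s _ =>
          hpf s (fun u => V s u * torusDeriv ψ u) ((hVs s).mul hψdc.measurable)
      simp only [← hψφ, hψ']
      rw [hIconv (fun u => (σ t u - p t u) * ψ u)]
      have e0 := fun s => hIconv (fun u => (σ s u - p s u) * (V s u * torusDeriv ψ u))
      simp only [e0]
      have hb : ∀ f : ℝ → Torus → ℝ, Measurable (Function.uncurry f) → ∀ M,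
          (∀ s ∈ Icc 0 T, Integrable (f s)) → (∀ s ∈ Icc 0 T, ∫ u, |f s u| ≤ M) →
          IntervalIntegrable (fun s => ∫ u, f s u * (V s u * torusDeriv ψ u)) volume 0 t := by
        intro f hf M hfi hfM
        have hB0 : 0 ≤ B' := (norm_nonneg _).trans (hB' 0 trivial)
        rw [intervalIntegrable_iff_integrableOn_Ioc_of_le ht.1]
        refine ((hV.integrable.mul_const (B' * M)).integrableOn).mono' ?_ ?_
        · have hmm : Measurable (Function.uncurry fun s u => f s u * (V s u * torusDeriv ψ u)) :=
            hf.mul (hV.measurable.mul (hψdc.measurable.comp measurable_snd))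
          exact hmm.stronglyMeasurable.integral_prod_right.aestronglyMeasurable
        · rw [ae_restrict_iff' measurableSet_Ioc]
          refine Eventually.of_forall fun s hs => ?_
          have hs' : s ∈ Icc 0 T := ⟨hs.1.le, hs.2.trans ht.2⟩
          have hLB : 0 ≤ L s * B' := mul_nonneg (hV.nonneg s) hB0
          calc ‖∫ u, f s u * (V s u * torusDeriv ψ u)‖ ≤ ∫ u, |f s u| * (L s * B') := by
                refine norm_integral_le_of_norm_le ((hfi s hs').abs.mul_const _)
                  (Eventually.of_forall fun u => ?_)
                rw [norm_mul, norm_mul, Real.norm_eq_abs (f s u)]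
                gcongr
                · exact hV.nonneg s
                · exact hV.bound s u
                · exact hB' u trivial
            _ ≤ L s * (B' * M) := by
                rw [MeasureTheory.integral_mul_const]
                linarith [mul_le_mul_of_nonneg_left (hfM s hs') hLB]
      have e3 : ∫ u, (σ t u - p t u) * ψ u = (∫ u, σ t u * ψ u) - ∫ u, p t u * ψ u := by
        rw [← MeasureTheory.integral_sub (hmulψ _ (hσi t ht)) (hmulψ _ (hpi t))]
        simp only [sub_mul]
      rw [e3, e1, eq_add_of_sub_eq e2'.symm, add_comm (∫ u, ψ u ∂μ), add_sub_add_right_eq_sub,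
        ← intervalIntegral.integral_sub (hb σ hσm K hσi hσK)
          (hb p hpm (μ.real univ) (fun s _ => hpi s) (fun s _ => (hpI s).le))]
      refine integral_congr_ae (Eventually.of_forall fun s hs => ?_)
      rw [uIoc_of_le ht.1] at hs
      have hs' : s ∈ Icc 0 T := ⟨hs.1.le, hs.2.trans ht.2⟩
      rw [← MeasureTheory.integral_sub (hmulV s _ (hσi s hs')) (hmulV s _ (hpi s))]
      simp only [sub_mul])
  intro t ht
  have h1 := key t ht
  rw [← hmp.map_eq]
  exact (ae_map_iff (p := fun u => σ t u - p t u = 0) hmp.measurable.aemeasurable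
    ((hσm.of_uncurry_left.sub (hpt t)) (measurableSet_singleton 0))).2 h1

end Transport

/-! ### Consequences of the weak formulation -/

/-- The `L¹` norm is the norm of the functional on continuous functions, up to a constant. -/
theorem integral_abs_le_of_forall_continuousMap {g : Torus → ℝ} (hg : Integrable g) {K : ℝ}
    (hK : ∀ f : C(Torus, ℝ), |∫ u, g u * f u| ≤ K * ‖f‖) (hK0 : 0 ≤ K) : ∫ u, |g u| ≤ K := by
  refine le_of_forall_pos_le_add fun δ hδ => ?_
  set ε : ℝ := δ / (2 + 2 * Real.pi) with hε
  have hε0 : 0 < ε := by positivity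
  obtain ⟨h, hh, hhi⟩ := hg.exists_boundedContinuous_integral_sub_le hε0
  -- `f = h / (|h| + ε)` approximates the sign of `g`
  have hpos : ∀ u, 0 < |h u| + ε := fun u => by positivity
  set f : C(Torus, ℝ) := ⟨fun u => h u / (|h u| + ε),
    h.continuous.div (h.continuous.abs.add continuous_const) fun u => (hpos u).ne'⟩ with hf
  have hf1 : ∀ u, |f u| ≤ 1 := fun u => by
    simp only [hf, ContinuousMap.coe_mk, abs_div, abs_of_pos (hpos u)]
    rw [div_le_one (hpos u)]
    linarith
  have hfn : ‖f‖ ≤ 1 := (ContinuousMap.norm_le _ zero_le_one).2 hf1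
  have hpt : ∀ u, |g u| ≤ g u * f u + 2 * |g u - h u| + ε := by
    intro u
    have h1 : |h u| - ε ≤ h u * f u := by
      simp only [hf, ContinuousMap.coe_mk]
      rw [mul_div_assoc', le_div_iff₀ (hpos u), ← abs_mul_abs_self (h u)]
      nlinarith [abs_nonneg (h u)]
    have h2 : |g u| ≤ |h u| + |g u - h u| := by
      have := abs_add_le (h u) (g u - h u)
      rwa [add_sub_cancel] at this
    have h3 : (h u - g u) * f u ≤ |g u - h u| := by
      refine (le_abs_self _).trans ?_
      rw [abs_mul, abs_sub_comm]
      exact mul_le_of_le_one_right (abs_nonneg _) (hf1 u)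
    linarith
  have hgf : Integrable (fun u => g u * f u) :=
    hg.mul_bdd (c := 1) f.continuous.aestronglyMeasurable (Eventually.of_forall hf1)
  have hgh : Integrable (fun u => 2 * |g u - h u|) := ((hg.sub hhi).abs).const_mul 2
  have hgfh : Integrable (fun u => g u * f u + 2 * |g u - h u|) := hgf.add hgh
  calc ∫ u, |g u| ≤ ∫ u, (g u * f u + 2 * |g u - h u| + ε) :=
        integral_mono hg.abs (hgfh.add (integrable_const ε)) hpt
    _ = (∫ u, g u * f u) + 2 * (∫ u, |g u - h u|) + 2 * Real.pi * ε := by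
        rw [MeasureTheory.integral_add hgfh (integrable_const ε),
          MeasureTheory.integral_add hgf hgh, MeasureTheory.integral_const_mul,
          MeasureTheory.integral_const, Measure.real, AddCircle.measure_univ,
          ENNReal.toReal_ofReal Real.two_pi_pos.le, smul_eq_mul]
    _ ≤ K + 2 * ε + 2 * Real.pi * ε := by
        have h1 := (le_abs_self _).trans (hK f)
        have h2 : K * ‖f‖ ≤ K := mul_le_of_le_one_right hK0 hfn
        have h3 : ∫ u, |g u - h u| ≤ ε := hh
        linarith
    _ = K + δ := by
        rw [hε]; field_simp; ring

/-- A weakly continuous family of densities on a compact parameter space is bounded in `L¹`, by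
the uniform boundedness principle. -/
theorem exists_integral_abs_le_of_weak_continuous {ι : Type*} [TopologicalSpace ι] [CompactSpace ι]
    {g : ι → Torus → ℝ} (hg : ∀ i, Integrable (g i))
    (hc : ∀ f : C(Torus, ℝ), Continuous fun i => ∫ u, g i u * f u) :
    ∃ K, ∀ i, ∫ u, |g i u| ≤ K := by
  have hgf : ∀ i, ∀ f : C(Torus, ℝ), Integrable (fun u => g i u * f u) := fun i f =>
    (hg i).mul_bdd (c := ‖f‖) f.continuous.aestronglyMeasurable
      (Eventually.of_forall fun u => f.norm_coe_le_norm u)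
  set Φ : ι → C(Torus, ℝ) →L[ℝ] ℝ := fun i =>
    LinearMap.mkContinuous
      { toFun := fun f => ∫ u, g i u * f u
        map_add' := fun f₁ f₂ => by
          simp only [ContinuousMap.add_apply, mul_add]
          exact MeasureTheory.integral_add (hgf i f₁) (hgf i f₂)
        map_smul' := fun c f => by
          simp only [ContinuousMap.smul_apply, smul_eq_mul, RingHom.id_apply, mul_left_comm _ c]
          exact MeasureTheory.integral_const_mul _ _ } (∫ u, |g i u|) fun f => by
      refine (MeasureTheory.norm_integral_le_of_norm_le ((hg i).abs.mul_const ‖f‖)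
        (Eventually.of_forall fun u => ?_)).trans (le_of_eq (MeasureTheory.integral_mul_const _ _))
      rw [norm_mul, Real.norm_eq_abs (g i u)]
      exact mul_le_mul_of_nonneg_left (f.norm_coe_le_norm u) (abs_nonneg _)
  have hΦ : ∀ i f, Φ i f = ∫ u, g i u * f u := fun i f => rfl
  obtain ⟨K, hK⟩ := banach_steinhaus (g := Φ) fun f => by
    obtain ⟨B, hB⟩ := isCompact_univ.exists_bound_of_continuousOn (hc f).continuousOn
    exact ⟨B, fun i => hB i trivial⟩
  refine ⟨max K 0, fun i => integral_abs_le_of_forall_continuousMap (hg i) (fun f => ?_)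
    (le_max_right _ _)⟩
  rw [← hΦ, ← Real.norm_eq_abs]
  exact ((Φ i).le_opNorm f).trans
    (mul_le_mul_of_nonneg_right ((hK i).trans (le_max_left _ _)) (norm_nonneg f))

/-- The weak formulation in time identifies a continuous function as a primitive. -/
theorem eq_add_integral_of_weak_deriv {T : ℝ} (hT : 0 < T) {m g : ℝ → ℝ} {m₀ : ℝ}
    (hm : Continuous m) (hg : IntervalIntegrable g volume 0 T)
    (h : ∀ χ : ℝ → ℝ, ContDiff ℝ 1 χ → (∃ T' < T, ∀ t ≥ T', χ t = 0) →
      (∫ t in (0 : ℝ)..T, (deriv χ t * m t + χ t * g t)) + χ 0 * m₀ = 0) :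
    ∀ t ∈ Icc 0 T, m t = m₀ + ∫ s in (0 : ℝ)..t, g s := by
  set G : ℝ → ℝ := fun t => m₀ + ∫ s in (0 : ℝ)..t, g s with hG
  have hG0 : G 0 = m₀ := by simp [hG]
  have hGc : ContinuousOn G (Icc 0 T) := by
    have := continuousOn_const (c := m₀) |>.add
      (continuousOn_primitive_interval' hg left_mem_uIcc)
    rwa [uIcc_of_le hT.le] at this
  have hmG : ContinuousOn (fun t => m t - G t) (Icc 0 T) := hm.continuousOn.sub hGc
  -- testing with `χ' = ζ`
  have hζ : ∀ ζ : ℝ → ℝ, Continuous ζ → ∀ T' < T, (∀ t ≥ T', ζ t = 0) →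
      ∫ t in (0 : ℝ)..T, ζ t * (m t - G t) = 0 := by
    intro ζ hζ T' hT' hz
    set χ : ℝ → ℝ := fun t => ∫ s in T'..t, ζ s with hχ
    have hχd : ∀ t, HasDerivAt χ (ζ t) t := fun t => (hζ.integral_hasStrictDerivAt T' t).hasDerivAt
    have hχ' : deriv χ = ζ := funext fun t => (hχd t).deriv
    have hχC : ContDiff ℝ 1 χ :=
      contDiff_one_iff_deriv.2 ⟨fun t => (hχd t).differentiableAt, hχ' ▸ hζ⟩
    have hχ0 : ∀ t ≥ T', χ t = 0 := fun t ht => by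
      simp only [hχ]
      rw [integral_congr (g := fun _ => (0 : ℝ)) fun s hs => hz s (by
        rw [uIcc_of_le ht] at hs; exact hs.1)]
      simp
    have k1 := h χ hχC ⟨T', hT', hχ0⟩
    rw [hχ'] at k1
    have hW : ContDiff ℝ 1 (fun y : ℝ × ℝ => y.1 * y.2) := by fun_prop
    have hfd : ∀ y w : ℝ × ℝ, fderiv ℝ (fun y : ℝ × ℝ => y.1 * y.2) y w
        = w.1 * y.2 + y.1 * w.2 := by
      intro y w
      have h3 : fderiv ℝ (fun y : ℝ × ℝ => y.1 * y.2) y = _ :=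
        ((hasFDerivAt_fst (𝕜 := ℝ)).mul hasFDerivAt_snd).fderiv
      rw [h3]
      simp
      ring
    have k2 := (integral_fderiv_comp hW (hζ.intervalIntegrable 0 T) hg (p := χ) (q := G)
      (fun t _ => by
        rw [← hχ', integral_deriv_eq_sub (fun x _ => (hχd x).differentiableAt)
          (hχ' ▸ hζ.intervalIntegrable _ _)]
        ring) (fun t _ => by simp [hG])).2
    simp only [hfd, hχ0 T hT'.le, hG0, zero_mul, zero_sub] at k2
    have i1 : IntervalIntegrable (fun t => ζ t * m t) volume 0 T :=
      (hζ.mul hm).intervalIntegrable _ _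
    have i2 : IntervalIntegrable (fun t => χ t * g t) volume 0 T :=
      hg.continuousOn_mul hχC.continuous.continuousOn
    have i3 : IntervalIntegrable (fun t => ζ t * G t) volume 0 T :=
      (hζ.continuousOn.mul (by rwa [uIcc_of_le hT.le])).intervalIntegrable
    rw [integral_add i1 i2] at k1
    rw [integral_add i3 i2] at k2
    simp only [mul_sub]
    rw [integral_sub i1 i3]
    linarith
  have hlt : ∀ t ∈ Ico 0 T, m t - G t = 0 := by
    intro t ht
    by_contra hne
    set T' := (t + T) / 2 with hT'
    have h1 : t < T' := by have := ht.2; linarith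
    have h2 : T' < T := by have := ht.2; linarith
    set H : ℝ → ℝ := fun s => m (projIcc 0 T hT.le s) - G (projIcc 0 T hT.le s) with hH
    have hHc : Continuous H :=
      (continuousOn_iff_continuous_domRestrict.1 hmG).comp continuous_projIcc
    have hHeq : ∀ s ∈ Icc 0 T, H s = m s - G s := fun s hs => by
      simp only [hH, projIcc_of_mem hT.le hs]
    have k := hζ (fun s => H s * max (T' - s) 0)
      (hHc.mul ((continuous_const.sub continuous_id).max continuous_const)) T' h2 fun s hs => by
        rw [max_eq_right (by linarith), mul_zero]
    have hpos : 0 < ∫ s in (0 : ℝ)..T, H s * max (T' - s) 0 * (m s - G s) := by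
      have hsq : ∀ s ∈ Icc 0 T, H s * max (T' - s) 0 * (m s - G s)
          = (m s - G s) ^ 2 * max (T' - s) 0 := fun s hs => by rw [hHeq s hs]; ring
      refine integral_pos hT ?_ (fun s hs => ?_) ⟨t, Ico_subset_Icc_self ht, ?_⟩
      · exact ((hHc.mul ((continuous_const.sub continuous_id).max
          continuous_const)).continuousOn).mul hmG
      · rw [hsq s (Ioc_subset_Icc_self hs)]
        positivity
      · rw [hsq t (Ico_subset_Icc_self ht), max_eq_left (by linarith)]
        have : 0 < (m t - G t) ^ 2 := by positivity
        exact mul_pos this (by linarith)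
    exact hpos.ne' k
  intro t ht
  refine sub_eq_zero.1 ?_
  have hclo : closure (Ico (0 : ℝ) T) = Icc 0 T := closure_Ico hT.ne
  have hE : EqOn (fun t => m t - G t) (fun _ => 0) (closure (Ico 0 T)) :=
    EqOn.of_subset_closure (s := Ico 0 T) hlt (by rw [hclo]; exact hmG)
      (by rw [hclo]; exact continuousOn_const) subset_closure le_rfl
  exact hE (by rwa [hclo])

/-! ### The characteristic field of a weak solution -/

section CharField

variable {Ω : Type*} [MeasurableSpace Ω] {D : Torus → ℝ}

theorem interaction_sub_le (hD : LipschitzWith 1 D) (a b : Torus) : |D a - D b| ≤ dist a b := by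
  have := hD.dist_le_mul a b
  rwa [NNReal.coe_one, one_mul, Real.dist_eq] at this

theorem integrable_mul_interaction (hD : LipschitzWith 1 D) (hDb : ∀ u, |D u| ≤ 1)
    {κ : Measure Ω} {S : Torus × Ω → ℝ} (hS : Integrable S (volume.prod κ)) (u : Torus) :
    Integrable (fun q => S q * D (q.1 - u)) (volume.prod κ) :=
  hS.mul_bdd (c := 1)
    ((hD.continuous.measurable.comp (measurable_fst.sub_const u)).aestronglyMeasurable)
    (Eventually.of_forall fun _ => hDb _)

/-- Fubini's theorem for the characteristic field. -/
theorem integral_integral_mul_interaction (hD : LipschitzWith 1 D) (hDb : ∀ u, |D u| ≤ 1)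
    {κ : Measure Ω} [SFinite κ] {S : Torus → Ω → ℝ}
    (hS : Integrable (fun q : Torus × Ω => S q.1 q.2) (volume.prod κ)) (u : Torus) :
    ∫ v, (∫ y, S v y ∂κ) * D (v - u) = ∫ q, S q.1 q.2 * D (q.1 - u) ∂(volume.prod κ) ∧
    ∫ v, (∫ y, S v y ∂κ) * D (v - u) = ∫ y, (∫ v, S v y * D (v - u)) ∂κ := by
  have h := integrable_mul_interaction hD hDb hS u
  have h1 : ∫ v, (∫ y, S v y ∂κ) * D (v - u) = ∫ q, S q.1 q.2 * D (q.1 - u) ∂(volume.prod κ) := by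
    rw [integral_prod _ h]
    simp only [MeasureTheory.integral_mul_const]
  exact ⟨h1, by rw [h1, integral_prod_symm _ h]⟩

open Classical in
/-- The field generated by an integrable family `S t` is Lipschitz in space, once it is set to zero
at the times where `S t` is not integrable. -/
theorem exists_isLipField_of_integrable (hD : LipschitzWith 1 D) (hDb : ∀ u, |D u| ≤ 1) {C : ℝ}
    (hC : 0 < C) {κ : Measure Ω} [IsFiniteMeasure κ] {T : ℝ} {S : ℝ → Torus → Ω → ℝ}
    (hSm : Measurable (fun p : ℝ × Torus × Ω => S p.1 p.2.1 p.2.2))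
    (hSi : Integrable (fun p : ℝ × Torus × Ω => S p.1 p.2.1 p.2.2)
      ((volume.restrict (Icc 0 T)).prod (volume.prod κ))) :
    ∃ V L, IsLipField V L ∧ ∀ᵐ s, s ∈ Icc 0 T →
      Integrable (fun q : Torus × Ω => S s q.1 q.2) (volume.prod κ) ∧
      ∀ u, V s u = C * ∫ v, (∫ y, S s v y ∂κ) * D (v - u) := by
  set G : Set ℝ := {s | s ∈ Icc 0 T ∧ Integrable (fun q : Torus × Ω => S s q.1 q.2) (volume.prod κ)}
    with hG
  have hGm : MeasurableSet G := by
    refine measurableSet_Icc.inter ?_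
    exact measurableSet_integrable (f := fun s (q : Torus × Ω) => S s q.1 q.2) hSm.stronglyMeasurable
  have hGae : ∀ᵐ s, s ∈ Icc 0 T → s ∈ G := by
    have h1 := hSi.prod_right_ae
    rw [ae_restrict_iff' measurableSet_Icc] at h1
    filter_upwards [h1] with s hs hs' using ⟨hs', hs hs'⟩
  refine ⟨fun s u => if s ∈ G then C * ∫ v, (∫ y, S s v y ∂κ) * D (v - u) else 0,
    fun s => if s ∈ G then C * ∫ q, |S s q.1 q.2| ∂(volume.prod κ) else 0, ⟨?_, ?_, ?_, ?_⟩, ?_⟩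
  · refine Measurable.ite (measurable_fst hGm) (measurable_const.mul ?_) measurable_const
    refine StronglyMeasurable.measurable (StronglyMeasurable.integral_prod_right
      (f := fun (p : ℝ × Torus) (v : Torus) => (∫ y, S p.1 v y ∂κ) * D (v - p.2)) ?_)
    refine StronglyMeasurable.mul ?_ ?_
    · exact StronglyMeasurable.integral_prod_right
        (f := fun (p : (ℝ × Torus) × Torus) (y : Ω) => S p.1.1 p.2 y)
        (hSm.comp ((measurable_fst.comp (measurable_fst.comp measurable_fst)).prodMk
          ((measurable_snd.comp measurable_fst).prodMk measurable_snd))).stronglyMeasurable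
    · exact (hD.continuous.measurable.comp (measurable_snd.sub
        (measurable_snd.comp measurable_fst))).stronglyMeasurable
  · have h1 : Integrable (fun s => C * ∫ q, |S s q.1 q.2| ∂(volume.prod κ))
        (volume.restrict (Icc 0 T)) := hSi.integral_norm_prod_left.const_mul C
    have h2 : (fun s => if s ∈ G then C * ∫ q, |S s q.1 q.2| ∂(volume.prod κ) else 0)
        = G.indicator (fun s => C * ∫ q, |S s q.1 q.2| ∂(volume.prod κ)) := by
      funext s; simp [indicator_apply]
    rw [h2, integrable_indicator_iff hGm]
    exact IntegrableOn.mono_set h1 fun s hs => hs.1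
  · intro s u
    by_cases hs : s ∈ G
    · simp only [hs, if_true]
      rw [(integral_integral_mul_interaction hD hDb hs.2 u).1, abs_mul, abs_of_pos hC]
      refine mul_le_mul_of_nonneg_left ?_ hC.le
      rw [← Real.norm_eq_abs]
      refine MeasureTheory.norm_integral_le_of_norm_le hs.2.abs (Eventually.of_forall fun q => ?_)
      rw [norm_mul]
      exact mul_le_of_le_one_right (abs_nonneg _) (hDb _)
    · simp [hs]
  · intro s u v
    by_cases hs : s ∈ G
    · simp only [hs, if_true]
      rw [(integral_integral_mul_interaction hD hDb hs.2 u).1,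
        (integral_integral_mul_interaction hD hDb hs.2 v).1, ← mul_sub, abs_mul, abs_of_pos hC,
        mul_assoc, ← MeasureTheory.integral_sub (integrable_mul_interaction hD hDb hs.2 u)
          (integrable_mul_interaction hD hDb hs.2 v), ← MeasureTheory.integral_mul_const]
      refine mul_le_mul_of_nonneg_left ?_ hC.le
      rw [← Real.norm_eq_abs]
      refine MeasureTheory.norm_integral_le_of_norm_le (hs.2.abs.mul_const _)
        (Eventually.of_forall fun q => ?_)
      rw [← mul_sub, norm_mul]
      refine mul_le_mul_of_nonneg_left ((interaction_sub_le hD _ _).trans ?_) (abs_nonneg _)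
      rw [dist_sub_left]
    · simp [hs]
  · filter_upwards [hGae] with s hs hsT
    have := hs hsT
    exact ⟨this.2, fun u => by simp [this]⟩

end CharField

/-! ### Representation of weak solutions by flows -/

theorem integral_timeMeasure {T : ℝ} (hT : 0 < T) (f : Icc (0 : ℝ) T → ℝ) :
    ∫ t, f t ∂(timeMeasure T) = ∫ t in (0 : ℝ)..T, f (projIcc 0 T hT.le t) := by
  rw [integral_of_le hT.le, ← integral_Icc_eq_integral_Ioc, timeMeasure,
    ← integral_subtype_comap measurableSet_Icc]
  simp only [projIcc_val]

theorem map_timeMeasure (T : ℝ) :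
    (timeMeasure T).map ((↑) : Icc (0 : ℝ) T → ℝ) = volume.restrict (Icc 0 T) :=
  map_comap_subtype_coe measurableSet_Icc _

instance isFiniteMeasure_timeMeasure (T : ℝ) : IsFiniteMeasure (timeMeasure T) := by
  refine ⟨?_⟩
  have h := Measure.map_apply (μ := timeMeasure T) (measurable_subtype_coe (p := (· ∈ Icc (0 : ℝ) T)))
    MeasurableSet.univ
  erw [map_timeMeasure, preimage_univ] at h
  rw [← h]
  simp

section Representation

variable {Ω : Type*} [MeasurableSpace Ω] {m : Measure Ω} {D : Torus → ℝ}

/-- At the node `x`, the family `σ` is the density of the initial measure transported by the flow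
`ξ` of its own characteristic field, of which `V` is a version that is Lipschitz at all times. -/
structure IsTransported (ν : Kernel Ω Ω) (C : ℝ) (D : Torus → ℝ) {T : ℝ} (hT : 0 < T)
    (μ₀ : Ω → Measure Torus) (σ : Icc (0 : ℝ) T → Torus → Ω → ℝ) (x : Ω)
    (V : ℝ → Torus → ℝ) (ξ : ℝ → Torus → ℝ) : Prop where
  lipField : ∃ L, IsLipField V L
  isFlow : IsFlow V ξ
  field : ∀ᵐ s, s ∈ Icc 0 T →
    Integrable (fun q : Torus × Ω => σ (projIcc 0 T hT.le s) q.1 q.2) (volume.prod (ν x)) ∧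
    ∀ u, V s u = charField ν C D σ (projIcc 0 T hT.le s) u x
  nonneg : ∀ t, ∀ᵐ u, 0 ≤ σ t u x
  map_eq : ∀ t : Icc (0 : ℝ) T, (μ₀ x).map (position ξ t)
    = volume.withDensity (fun u => ENNReal.ofReal (σ t u x))

theorem HasDensity.absolutelyContinuous {μ₀ : Ω → Measure Torus} {ρ₀ : Torus → Ω → ℝ}
    (h : HasDensity μ₀ ρ₀) (x : Ω) : μ₀ x ≪ volume := by
  rw [h.eq]; exact withDensity_absolutelyContinuous _ _

theorem HasDensity.integral_eq {μ₀ : Ω → Measure Torus} {ρ₀ : Torus → Ω → ℝ}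
    (h : HasDensity μ₀ ρ₀) (x : Ω) (f : Torus → ℝ) :
    ∫ u, f u ∂(μ₀ x) = ∫ u, ρ₀ u x * f u := by
  rw [h.eq]
  exact integral_withDensity_ofReal (g := fun u => ρ₀ u x)
    (h.measurable.comp (measurable_id.prodMk measurable_const)) (h.nonneg x) f

/-- Almost every fiber of a weak solution is transported by the flow of its characteristic field,
without any assumption on `σ` that is uniform in `x`. -/
theorem IsWeakSolution.exists_isTransported {ν : Kernel Ω Ω} [IsFiniteKernel ν] {C : ℝ} (hC : 0 < C)
    (hD : LipschitzWith 1 D) (hDb : ∀ u, |D u| ≤ 1) {T : ℝ} (hT : 0 < T)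
    {μ₀ : Ω → Measure Torus} [∀ x, IsFiniteMeasure (μ₀ x)] {ρ₀ : Torus → Ω → ℝ}
    (hρ₀ : HasDensity μ₀ ρ₀) {σ : Icc (0 : ℝ) T → Torus → Ω → ℝ}
    (hσ : IsWeakSolution m ν C D T ρ₀ σ) :
    ∀ᵐ x ∂m, ∃ V ξ, IsTransported ν C D hT μ₀ σ x V ξ := by
  filter_upwards [hσ.integrable, hσ.integrable_fiber, hσ.weak_continuous, hσ.weak_eq]
    with x hint hfib hcont hweak
  set pr : ℝ → Icc (0 : ℝ) T := projIcc 0 T hT.le with hpr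
  have hprm : Measurable pr := continuous_projIcc.measurable
  set S : ℝ → Torus → Ω → ℝ := fun s => σ (pr s) with hS
  have hSm : Measurable (fun p : ℝ × Torus × Ω => S p.1 p.2.1 p.2.2) :=
    hσ.measurable.comp ((hprm.comp measurable_fst).prodMk measurable_snd)
  have hSi : Integrable (fun p : ℝ × Torus × Ω => S p.1 p.2.1 p.2.2)
      ((volume.restrict (Icc 0 T)).prod (volume.prod (ν x))) := by
    have hemb : MeasurableEmbedding
        (Prod.map ((↑) : Icc (0 : ℝ) T → ℝ) (id : Torus × Ω → Torus × Ω)) :=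
      (MeasurableEmbedding.subtype_coe measurableSet_Icc).prodMap MeasurableEmbedding.id
    have hmap : ((timeMeasure T).prod ((volume : Measure Torus).prod (ν x))).map
        (Prod.map ((↑) : Icc (0 : ℝ) T → ℝ) (id : Torus × Ω → Torus × Ω))
        = (volume.restrict (Icc 0 T)).prod (volume.prod (ν x)) := by
      rw [← Measure.map_prod_map _ _ measurable_subtype_coe measurable_id, map_timeMeasure,
        Measure.map_id]
    rw [← hmap, hemb.integrable_map_iff]
    convert hfib using 1
    funext p
    simp [hS, hpr, projIcc_val]
  obtain ⟨V, L, hV, hVae⟩ := exists_isLipField_of_integrable hD hDb hC hSm hSi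
  obtain ⟨ξ, hξ⟩ := hV.exists_isFlow
  obtain ⟨K, hK⟩ := exists_integral_abs_le_of_weak_continuous hint hcont
  have hSxm : Measurable (Function.uncurry fun s u => S s u x) :=
    hSm.comp (measurable_fst.prodMk (measurable_snd.prodMk measurable_const))
  have hSint : ∀ s, Integrable (fun u => S s u x) := fun s => hint _
  have hVs : ∀ s, Measurable (V s) := fun s => hV.measurable.of_uncurry_left
  -- the weak formulation, integrated in time
  have heq : ∀ φ : Torus → ℝ, ContDiff ℝ 1 (fun a : ℝ => φ (a : Torus)) → ∀ t ∈ Icc 0 T,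
      ∫ u, S t u x * φ u
        = (∫ u, φ u ∂(μ₀ x)) + ∫ s in (0 : ℝ)..t, ∫ u, S s u x * (V s u * torusDeriv φ u) := by
    intro φ hφ
    have hφw : ContDiff ℝ 1 (fun q : ℝ × ℝ => (fun _ : ℝ => φ) q.1 (q.2 : Torus)) :=
      hφ.comp contDiff_snd
    have hφc : Continuous φ :=
      (continuous_uncurry_of_contDiff (w := fun _ => φ) hφw).comp
        (continuous_const (y := (0 : ℝ)) |>.prodMk continuous_id)
    have hφdc : Continuous (torusDeriv φ) :=
      (continuous_space_deriv (w := fun _ => φ) hφw).comp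
        (continuous_const (y := (0 : ℝ)) |>.prodMk continuous_id)
    obtain ⟨B, hB⟩ := isCompact_univ.exists_bound_of_continuousOn hφc.continuousOn
    obtain ⟨B', hB'⟩ := isCompact_univ.exists_bound_of_continuousOn hφdc.continuousOn
    have hB0 : 0 ≤ B' := (norm_nonneg _).trans (hB' 0 trivial)
    have i1 : ∀ s, Integrable (fun u => S s u x * φ u) := fun s =>
      (hSint s).mul_bdd (c := B) hφc.aestronglyMeasurable (Eventually.of_forall fun u => hB u trivial)
    have i2 : ∀ s, Integrable (fun u => S s u x * (V s u * torusDeriv φ u)) := fun s =>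
      (hSint s).mul_bdd (c := L s * B') ((hVs s).mul hφdc.measurable).aestronglyMeasurable
        (Eventually.of_forall fun u => by
          rw [norm_mul]
          exact mul_le_mul (hV.bound s u) (hB' u trivial) (norm_nonneg _) (hV.nonneg s))
    refine eq_add_integral_of_weak_deriv hT (m := fun t => ∫ u, S t u x * φ u)
      (g := fun s => ∫ u, S s u x * (V s u * torusDeriv φ u)) ?_ ?_ ?_
    · exact (hcont ⟨φ, hφc⟩).comp continuous_projIcc
    · refine Integrable.intervalIntegrable ((hV.integrable.mul_const (B' * K)).mono' ?_ ?_)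
      · have hmm : Measurable (Function.uncurry fun s u => S s u x * (V s u * torusDeriv φ u)) :=
          hSxm.mul (hV.measurable.mul (hφdc.measurable.comp measurable_snd))
        exact hmm.stronglyMeasurable.integral_prod_right.aestronglyMeasurable
      · refine Eventually.of_forall fun s => ?_
        have hLB : 0 ≤ L s * B' := mul_nonneg (hV.nonneg s) hB0
        calc ‖∫ u, S s u x * (V s u * torusDeriv φ u)‖ ≤ ∫ u, |S s u x| * (L s * B') := by
              refine MeasureTheory.norm_integral_le_of_norm_le ((hSint s).abs.mul_const _)
                (Eventually.of_forall fun u => ?_)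
              rw [norm_mul, norm_mul, Real.norm_eq_abs (S s u x)]
              gcongr
              · exact hV.nonneg s
              · exact hV.bound s u
              · exact hB' u trivial
          _ ≤ L s * (B' * K) := by
              rw [MeasureTheory.integral_mul_const]
              have : ∫ u, |S s u x| ≤ K := hK (pr s)
              linarith [mul_le_mul_of_nonneg_left this hLB]
    · intro χ hχ hχ0
      have hw : IsTestFunction T (fun t u => χ t * φ u) := by
        refine ⟨(hχ.comp contDiff_fst).mul (hφ.comp contDiff_snd), ?_⟩
        obtain ⟨T', hT', hz⟩ := hχ0
        exact ⟨T', hT', fun t ht u => by rw [hz t ht, zero_mul]⟩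
      have k := hweak _ hw
      rw [integral_timeMeasure hT] at k
      have e0 : ∫ u, χ 0 * φ u * ρ₀ u x = χ 0 * ∫ u, φ u ∂(μ₀ x) := by
        rw [hρ₀.integral_eq, ← MeasureTheory.integral_const_mul]
        refine MeasureTheory.integral_congr_ae (Eventually.of_forall fun u => ?_)
        simp only; ring
      rw [e0] at k
      refine Eq.trans ?_ k
      congr 1
      refine integral_congr_ae ?_
      filter_upwards [hVae] with s hs hsT
      rw [uIoc_of_le hT.le] at hsT
      have hsT' := Ioc_subset_Icc_self hsT
      have hps : ((pr s : Icc (0 : ℝ) T) : ℝ) = s := by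
        rw [hpr, projIcc_of_mem hT.le hsT']
      obtain ⟨-, hVeq⟩ := hs hsT'
      have hVeq' : ∀ u, charField ν C D σ (pr s) u x = V s u := fun u => (hVeq u).symm
      rw [hps, ← MeasureTheory.integral_const_mul, ← MeasureTheory.integral_const_mul,
        ← MeasureTheory.integral_add ((i1 s).const_mul _) ((i2 s).const_mul _)]
      refine MeasureTheory.integral_congr_ae (Eventually.of_forall fun u => ?_)
      have d1 : deriv (fun r : ℝ => χ r * φ u) s = deriv χ s * φ u := by
        rw [deriv_mul_const_field]
      have d2 : torusDeriv (fun u => χ s * φ u) u = χ s * torusDeriv φ u := by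
        unfold torusDeriv
        rw [deriv_const_mul_field]
      have hVu := hVeq' u
      simp only [hpr] at hVu
      simp only [d1, d2, hVu, hS, hpr]
      ring
  have key := hξ.map_eq_withDensity_of_continuityEquation hV (hρ₀.absolutelyContinuous x)
    (σ := fun s u => S s u x) hSxm (fun t _ => hSint t) (fun t _ => hK _) heq
  refine ⟨V, ξ, ⟨L, hV⟩, hξ, hVae, fun t => ?_, fun t => ?_⟩
  · have := (key t t.2).1
    simpa [hS, hpr, projIcc_val] using this
  · have := (key t t.2).2
    simpa [hS, hpr, projIcc_val] using this

end Representation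

/-! ### Uniqueness of weak solutions -/

section Uniqueness

variable {Ω : Type*} [MeasurableSpace Ω] {m : Measure Ω} {D : Torus → ℝ}

/-- A null set `N` of nodes is `ν x`-null for almost every `x`: the graphop maps the class of its
indicator, which is zero, to `x ↦ ν x N`. -/
theorem IsFiberFamily.ae_ae {A : Lp ℝ ∞ m →L[ℝ] Lp ℝ 1 m} {ν : Kernel Ω Ω}
    (hν : IsFiberFamily A ν) {P : Ω → Prop} (hP : ∀ᵐ x ∂m, P x) : ∀ᵐ x ∂m, ∀ᵐ y ∂(ν x), P y := by
  obtain ⟨N, hPN, hNm, hN⟩ := exists_measurable_superset_of_null (ae_iff.1 hP)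
  have hf0 : (N.indicator fun _ => (1 : ℝ)) =ᵐ[m] 0 := by
    filter_upwards [measure_eq_zero_iff_ae_notMem.1 hN] with x hx
    simp [hx]
  have hf : MemLp (N.indicator fun _ => (1 : ℝ)) ∞ m := MemLp.ae_eq hf0.symm MemLp.zero
  have hA : A (hf.toLp _) = 0 := by
    rw [(MemLp.toLp_eq_toLp_iff hf MemLp.zero).2 hf0]
    exact map_zero A
  have h0 := Lp.coeFn_zero ℝ 1 m
  filter_upwards [hν.repr _ hf, h0] with x hx hx0
  rw [hA, hx0, Pi.zero_apply, integral_indicator_const _ hNm, smul_eq_mul, mul_one] at hx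
  have hfin : ν x N ≠ ∞ := (measure_mono (subset_univ N)).trans_lt (hν.finite x) |>.ne
  have hνN : ν x N = 0 := ((ENNReal.toReal_eq_zero_iff _).1 hx.symm).resolve_right hfin
  exact ae_iff.2 (measure_mono_null hPN hνN)

theorem IsTransported.integral_eq {ν : Kernel Ω Ω} {C T : ℝ} {hT : 0 < T} {μ₀ : Ω → Measure Torus}
    {σ : Icc (0 : ℝ) T → Torus → Ω → ℝ} {x : Ω} {V ξ : ℝ → Torus → ℝ}
    (h : IsTransported ν C D hT μ₀ σ x V ξ)
    (hσ : Measurable (fun p : Icc (0 : ℝ) T × Torus × Ω => σ p.1 p.2.1 p.2.2))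
    (t : Icc (0 : ℝ) T) {f : Torus → ℝ} (hf : Measurable f) :
    ∫ u, σ t u x * f u = ∫ u, f (position ξ t u) ∂(μ₀ x) := by
  have hm : Measurable (fun u => σ t u x) :=
    hσ.comp (measurable_const.prodMk (measurable_id.prodMk measurable_const))
  rw [← integral_withDensity_ofReal hm (h.nonneg t), ← h.map_eq t,
    integral_map (measurable_position h.isFlow.measurable).of_uncurry_left.aemeasurable
      hf.aestronglyMeasurable]

/-- One step of the comparison of the flows of two solutions: a bound for the difference of the
interactions at `ν x`-almost all nodes improves the bound for the displacements at `x`. -/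
theorem abs_displacement_sub_le (hD : LipschitzWith 1 D) (hDb : ∀ u, |D u| ≤ 1)
    {ν : Kernel Ω Ω} [IsFiniteKernel ν] {x : Ω} (hνx : (ν x).real univ ≤ 1)
    {C : ℝ} (hC : 0 < C) {T : ℝ} {hT : 0 < T} {b : ℝ} {μ₀ : Ω → Measure Torus}
    [∀ x, IsFiniteMeasure (μ₀ x)] (hμb : ∀ x, (μ₀ x).real univ ≤ b)
    {σ₁ σ₂ : Icc (0 : ℝ) T → Torus → Ω → ℝ}
    (hσ₁ : Measurable (fun p : Icc (0 : ℝ) T × Torus × Ω => σ₁ p.1 p.2.1 p.2.2))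
    (hσ₂ : Measurable (fun p : Icc (0 : ℝ) T × Torus × Ω => σ₂ p.1 p.2.1 p.2.2))
    {V₁ V₂ ξ₁ ξ₂ : Ω → ℝ → Torus → ℝ}
    (h₁ : IsTransported ν C D hT μ₀ σ₁ x (V₁ x) (ξ₁ x))
    (h₂ : IsTransported ν C D hT μ₀ σ₂ x (V₂ x) (ξ₂ x))
    (h₁' : ∀ᵐ y ∂(ν x), IsTransported ν C D hT μ₀ σ₁ y (V₁ y) (ξ₁ y))
    (h₂' : ∀ᵐ y ∂(ν x), IsTransported ν C D hT μ₀ σ₂ y (V₂ y) (ξ₂ y))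
    {L : ℝ → ℝ} (hL : Integrable L) (hLT : ∀ s ∈ Icc 0 T, L s = 2 * C * b) {K : ℝ} (hK : 0 ≤ K)
    (hdiff : ∀ᵐ y ∂(ν x), ∀ s ∈ Icc 0 T, ∀ u v,
      |D (position (ξ₁ y) s v - position (ξ₁ x) s u) - D (position (ξ₂ y) s v - position (ξ₂ x) s u)|
        ≤ 2 * K * expWeight L s) :
    ∀ t ∈ Icc 0 T, ∀ u, |ξ₁ x t u - ξ₂ x t u| ≤ K / 2 * expWeight L t := by
  intro t ht u
  obtain ⟨L₁, hV₁⟩ := h₁.lipField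
  obtain ⟨L₂, hV₂⟩ := h₂.lipField
  rw [h₁.isFlow.eq_integral, h₂.isFlow.eq_integral,
    ← intervalIntegral.integral_sub (hV₁.intervalIntegrable_position h₁.isFlow.measurable u _ _)
      (hV₂.intervalIntegrable_position h₂.isFlow.measurable u _ _)]
  refine abs_integral_le_half_expWeight hL hK ?_
  filter_upwards [h₁.field, h₂.field] with s hs₁ hs₂ hs
  rw [max_eq_left ht.1] at hs
  have hsT : s ∈ Icc 0 T := ⟨hs.1.le, hs.2.trans ht.2⟩
  obtain ⟨i₁, e₁⟩ := hs₁ hsT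
  obtain ⟨i₂, e₂⟩ := hs₂ hsT
  set r : Icc (0 : ℝ) T := projIcc 0 T hT.le s with hr
  have hrs : (r : ℝ) = s := by rw [hr, projIcc_of_mem hT.le hsT]
  set z₁ := position (ξ₁ x) s u
  set z₂ := position (ξ₂ x) s u
  have f₁ : V₁ x s z₁ = C * ∫ y, (∫ v, σ₁ r v y * D (v - z₁)) ∂(ν x) := by
    rw [e₁, ← (integral_integral_mul_interaction hD hDb i₁ z₁).2]; rfl
  have f₂ : V₂ x s z₂ = C * ∫ y, (∫ v, σ₂ r v y * D (v - z₂)) ∂(ν x) := by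
    rw [e₂, ← (integral_integral_mul_interaction hD hDb i₂ z₂).2]; rfl
  have hDm : ∀ z, Measurable (fun v => D (v - z)) := fun z =>
    hD.continuous.measurable.comp (measurable_id.sub_const z)
  have hw0 : 0 ≤ 2 * K * expWeight L s := mul_nonneg (by linarith) (expWeight_pos L s).le
  have hb : 0 ≤ b := measureReal_nonneg.trans (hμb x)
  have hbound : ∀ᵐ y ∂(ν x), ‖(∫ v, σ₁ r v y * D (v - z₁)) - ∫ v, σ₂ r v y * D (v - z₂)‖
      ≤ 2 * K * expWeight L s * b := by
    filter_upwards [h₁', h₂', hdiff] with y hy₁ hy₂ hy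
    rw [hy₁.integral_eq hσ₁ r (hDm z₁), hy₂.integral_eq hσ₂ r (hDm z₂), hrs]
    have hp : ∀ ξ : ℝ → Torus → ℝ, Measurable (Function.uncurry ξ) → ∀ z,
        Integrable (fun v => D (position ξ s v - z)) (μ₀ y) := fun ξ hξ z =>
      Integrable.of_bound ((hDm z).comp
        (measurable_position hξ).of_uncurry_left).aestronglyMeasurable 1
        (Eventually.of_forall fun _ => hDb _)
    rw [← MeasureTheory.integral_sub (hp _ hy₁.isFlow.measurable z₁)
      (hp _ hy₂.isFlow.measurable z₂)]
    refine (norm_integral_le_of_norm_le_const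
      (Eventually.of_forall fun v => hy s hsT u v)).trans ?_
    exact mul_le_mul_of_nonneg_left (hμb y) hw0
  rw [f₁, f₂, ← mul_sub, abs_mul, abs_of_pos hC, hLT s hsT,
    ← MeasureTheory.integral_sub (integrable_mul_interaction hD hDb i₁ z₁).integral_prod_right
      (integrable_mul_interaction hD hDb i₂ z₂).integral_prod_right]
  have hI := norm_integral_le_of_norm_le_const hbound
  have hI' : 2 * K * expWeight L s * b * (ν x).real univ ≤ 2 * K * expWeight L s * b :=
    mul_le_of_le_one_right (mul_nonneg hw0 hb) hνx
  calc C * |∫ y, ((∫ v, σ₁ r v y * D (v - z₁)) - ∫ v, σ₂ r v y * D (v - z₂)) ∂(ν x)|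
      ≤ C * (2 * K * expWeight L s * b) := mul_le_mul_of_nonneg_left (hI.trans hI') hC.le
    _ = 2 * C * b * (K * expWeight L s) := by ring

/-- Weak solutions with the same initial value agree: their displacements differ by at most
`2⁻ⁿ⁻¹ e^{2Λ}` for all `n`, by iteration over the nodes that interact. -/
theorem IsWeakSolution.ae_eq {A : Lp ℝ ∞ m →L[ℝ] Lp ℝ 1 m} {ν : Kernel Ω Ω} [IsFiniteKernel ν]
    (hν : IsFiberFamily A ν) (hν1 : ∀ x, (ν x).real univ ≤ 1) {C : ℝ} (hC : 0 < C)
    (hD : LipschitzWith 1 D) (hDb : ∀ u, |D u| ≤ 1) {T : ℝ} (hT : 0 < T) {b : ℝ}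
    {μ₀ : Ω → Measure Torus} [∀ x, IsFiniteMeasure (μ₀ x)] (hμb : ∀ x, (μ₀ x).real univ ≤ b)
    {ρ₀ : Torus → Ω → ℝ} (hρ₀ : HasDensity μ₀ ρ₀) {σ₁ σ₂ : Icc (0 : ℝ) T → Torus → Ω → ℝ}
    (h₁ : IsWeakSolution m ν C D T ρ₀ σ₁) (h₂ : IsWeakSolution m ν C D T ρ₀ σ₂) :
    ∀ᵐ x ∂m, ∀ t, ∀ᵐ u, σ₁ t u x = σ₂ t u x := by
  have hch : ∀ {σ : Icc (0 : ℝ) T → Torus → Ω → ℝ},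
      (∀ᵐ x ∂m, ∃ V ξ, IsTransported ν C D hT μ₀ σ x V ξ) →
      ∃ V ξ : Ω → ℝ → Torus → ℝ, ∀ᵐ x ∂m, IsTransported ν C D hT μ₀ σ x (V x) (ξ x) := by
    intro σ h
    have h' : ∀ x, ∃ V ξ, (∃ V ξ, IsTransported ν C D hT μ₀ σ x V ξ) →
        IsTransported ν C D hT μ₀ σ x V ξ := fun x => by
      by_cases hx : ∃ V ξ, IsTransported ν C D hT μ₀ σ x V ξ
      · obtain ⟨V, ξ, hVξ⟩ := hx
        exact ⟨V, ξ, fun _ => hVξ⟩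
      · exact ⟨0, 0, fun h => absurd h hx⟩
    choose V ξ hVξ using h'
    exact ⟨V, ξ, h.mono hVξ⟩
  obtain ⟨V₁, ξ₁, ht₁⟩ := hch (h₁.exists_isTransported hC hD hDb hT hρ₀)
  obtain ⟨V₂, ξ₂, ht₂⟩ := hch (h₂.exists_isTransported hC hD hDb hT hρ₀)
  set L : ℝ → ℝ := (Icc 0 T).indicator fun _ => 2 * C * b with hL
  have hLi : Integrable L := by
    rw [hL, integrable_indicator_iff measurableSet_Icc]
    exact continuous_const.integrableOn_Icc
  have hLT : ∀ s ∈ Icc 0 T, L s = 2 * C * b := fun s hs => indicator_of_mem hs _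
  -- the bound `|D| ≤ 1` starts the iteration: interactions differ by at most `2 K` with `K = 1`
  have key : ∀ n : ℕ, ∀ᵐ x ∂m, ∀ t ∈ Icc 0 T, ∀ u,
      |ξ₁ x t u - ξ₂ x t u| ≤ (1 / 2) / 2 ^ n * expWeight L t := by
    intro n
    induction n with
    | zero =>
      filter_upwards [ht₁, ht₂, hν.ae_ae ht₁, hν.ae_ae ht₂] with x a₁ a₂ a₁' a₂' t ht u
      have hb : 0 ≤ b := measureReal_nonneg.trans (hμb x)
      have hL0 : ∀ s, 0 ≤ L s := fun s => indicator_nonneg (fun _ _ => by positivity) s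
      have := abs_displacement_sub_le hD hDb (hν1 x) hC hμb h₁.measurable h₂.measurable a₁ a₂ a₁' a₂'
        hLi hLT zero_le_one (Eventually.of_forall fun y s _ u v => by
          have := one_le_expWeight hL0 s
          refine (abs_sub _ _).trans ?_
          linarith [hDb (position (ξ₁ y) s v - position (ξ₁ x) s u),
            hDb (position (ξ₂ y) s v - position (ξ₂ x) s u)]) t ht u
      simpa using this
    | succ n ih =>
      filter_upwards [ht₁, ht₂, hν.ae_ae ht₁, hν.ae_ae ht₂, ih, hν.ae_ae ih]
        with x a₁ a₂ a₁' a₂' c c'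
      rw [pow_succ, ← div_div]
      refine abs_displacement_sub_le hD hDb (hν1 x) hC hμb h₁.measurable h₂.measurable a₁ a₂ a₁' a₂'
        hLi hLT (by positivity) ?_
      filter_upwards [c'] with y hy s hs u v
      refine (interaction_sub_le hD _ _).trans ((dist_sub_sub_le _ _ _ _).trans ?_)
      have d₁ := (dist_add_coe_le v (ξ₁ y s v) (ξ₂ y s v)).trans (hy s hs v)
      have d₂ := (dist_add_coe_le u (ξ₁ x s u) (ξ₂ x s u)).trans (c s hs u)
      refine (add_le_add d₁ d₂).trans (le_of_eq ?_)
      ring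
  filter_upwards [ht₁, ht₂, ae_all_iff.2 key] with x a₁ a₂ hx t
  have hξ : position (ξ₁ x) t = position (ξ₂ x) t := by
    funext u
    have : ξ₁ x t u = ξ₂ x t u :=
      sub_eq_zero.1 (eq_zero_of_forall_abs_le_half_pow fun n => hx n t t.2 u)
    simp only [position, this]
  have hm : ∀ {σ : Icc (0 : ℝ) T → Torus → Ω → ℝ},
      Measurable (fun p : Icc (0 : ℝ) T × Torus × Ω => σ p.1 p.2.1 p.2.2) →
      AEMeasurable (fun u => ENNReal.ofReal (σ t u x)) := fun h =>
    (h.comp (measurable_const.prodMk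
      (measurable_id.prodMk measurable_const))).ennreal_ofReal.aemeasurable
  have hd : volume.withDensity (fun u => ENNReal.ofReal (σ₁ t u x))
      = volume.withDensity (fun u => ENNReal.ofReal (σ₂ t u x)) := by
    rw [← a₁.map_eq t, ← a₂.map_eq t, hξ]
  have hd' := (withDensity_eq_iff_of_sigmaFinite (hm h₁.measurable) (hm h₂.measurable)).1 hd
  filter_upwards [hd', a₁.nonneg t, a₂.nonneg t] with u hu n₁ n₂
  exact (ENNReal.ofReal_eq_ofReal_iff n₁ n₂).1 hu

end Uniqueness

/-! ### Existence of weak solutions -/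

section Existence

variable {Ω : Type*} [MeasurableSpace Ω] {m : Measure Ω} {D : Torus → ℝ}

/-- The mean field generated by the particles with displacements `Ξ (s, v, y)`, the particles at the
node `y` being distributed initially according to `μ y`. It is set to zero off `[0, T]`. -/
def meanField (ν : Kernel Ω Ω) (μ : Kernel Ω Torus) (C : ℝ) (D : Torus → ℝ) (T : ℝ)
    (Ξ : ℝ × Torus × Ω → ℝ) (x : Ω) (s : ℝ) (z : Torus) : ℝ :=
  (Icc 0 T).indicator
    (fun s => C * ∫ y, (∫ v, D (v + (Ξ (s, v, y) : Torus) - z) ∂(μ y)) ∂(ν x)) s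

variable {ν : Kernel Ω Ω} [IsFiniteKernel ν] {μ : Kernel Ω Torus} [IsFiniteKernel μ] {C T b : ℝ}
  {Ξ Ξ' : ℝ × Torus × Ω → ℝ}

theorem measurable_interaction (hD : LipschitzWith 1 D) (hΞ : Measurable Ξ) :
    Measurable (fun q : (ℝ × Torus × Ω) × Torus =>
      D (q.2 + (Ξ (q.1.1, q.2, q.1.2.2) : Torus) - q.1.2.1)) := by
  refine hD.continuous.measurable.comp (Measurable.sub (measurable_snd.add
    (AddCircle.measurable_mk'.comp (hΞ.comp ?_))) (by fun_prop))
  fun_prop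

/-- The interaction with the particles at a node depends measurably on time, position and node. -/
theorem measurable_integral_interaction (hD : LipschitzWith 1 D) (hΞ : Measurable Ξ) :
    Measurable (fun p : ℝ × Torus × Ω =>
      ∫ v, D (v + (Ξ (p.1, v, p.2.2) : Torus) - p.2.1) ∂(μ p.2.2)) := by
  have h := StronglyMeasurable.integral_kernel_prod_right
    (κ := μ.comap (fun p : ℝ × Torus × Ω => p.2.2) (by fun_prop))
    (f := fun (p : ℝ × Torus × Ω) (v : Torus) => D (v + (Ξ (p.1, v, p.2.2) : Torus) - p.2.1))
    (measurable_interaction hD hΞ).stronglyMeasurable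
  simpa only [Kernel.comap_apply] using h.measurable

theorem measurable_meanField (hD : LipschitzWith 1 D) (hΞ : Measurable Ξ) :
    Measurable (fun p : ℝ × Torus × Ω => meanField ν μ C D T Ξ p.2.2 p.1 p.2.1) := by
  have h := StronglyMeasurable.integral_kernel_prod_right
    (κ := ν.comap (fun p : ℝ × Torus × Ω => p.2.2) (by fun_prop))
    (f := fun (p : ℝ × Torus × Ω) (y : Ω) =>
      ∫ v, D (v + (Ξ (p.1, v, y) : Torus) - p.2.1) ∂(μ y))
    ((measurable_integral_interaction hD hΞ).comp
      (g := fun p : ℝ × Torus × Ω =>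
        ∫ v, D (v + (Ξ (p.1, v, p.2.2) : Torus) - p.2.1) ∂(μ p.2.2))
      (f := fun q : (ℝ × Torus × Ω) × Ω => (q.1.1, q.1.2.1, q.2)) (by fun_prop)).stronglyMeasurable
  simp only [Kernel.comap_apply] at h
  have h2 : (fun p : ℝ × Torus × Ω => meanField ν μ C D T Ξ p.2.2 p.1 p.2.1)
      = (Prod.fst ⁻¹' Icc (0 : ℝ) T).indicator (fun p : ℝ × Torus × Ω =>
        C * ∫ y, (∫ v, D (v + (Ξ (p.1, v, y) : Torus) - p.2.1) ∂(μ y)) ∂(ν p.2.2)) := by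
    funext p
    rfl
  rw [h2]
  exact (h.measurable.const_mul C).indicator (measurable_fst measurableSet_Icc)

theorem norm_integral_interaction_le (hDb : ∀ u, |D u| ≤ 1) (hμb : ∀ x, (μ x).real univ ≤ b)
    (s : ℝ) (z : Torus) (y : Ω) :
    ‖∫ v, D (v + (Ξ (s, v, y) : Torus) - z) ∂(μ y)‖ ≤ b := by
  have := norm_integral_le_of_norm_le_const (μ := μ y) (C := 1)
    (f := fun v => D (v + (Ξ (s, v, y) : Torus) - z)) (Eventually.of_forall fun _ => hDb _)
  linarith [hμb y]

theorem integrable_integral_interaction (hD : LipschitzWith 1 D) (hDb : ∀ u, |D u| ≤ 1)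
    (hμb : ∀ x, (μ x).real univ ≤ b) (hΞ : Measurable Ξ) (s : ℝ) (z : Torus) (x : Ω) :
    Integrable (fun y => ∫ v, D (v + (Ξ (s, v, y) : Torus) - z) ∂(μ y)) (ν x) :=
  Integrable.of_bound ((measurable_integral_interaction hD hΞ).comp
    (g := fun p : ℝ × Torus × Ω => ∫ v, D (v + (Ξ (p.1, v, p.2.2) : Torus) - p.2.1) ∂(μ p.2.2))
    (f := fun y : Ω => (s, z, y)) (by fun_prop)).aestronglyMeasurable b
    (Eventually.of_forall fun y => norm_integral_interaction_le hDb hμb s z y)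

theorem abs_meanField_le (hDb : ∀ u, |D u| ≤ 1) (hC : 0 < C) (hν1 : ∀ x, (ν x).real univ ≤ 1)
    (hμb : ∀ x, (μ x).real univ ≤ b) (x : Ω) (s : ℝ) (z : Torus) :
    |meanField ν μ C D T Ξ x s z| ≤ (Icc 0 T).indicator (fun _ => C * b) s := by
  by_cases hs : s ∈ Icc 0 T
  · simp only [meanField, indicator_of_mem hs]
    rw [abs_mul, abs_of_pos hC]
    refine mul_le_mul_of_nonneg_left ?_ hC.le
    have hb : 0 ≤ b := measureReal_nonneg.trans (hμb x)
    exact (norm_integral_le_of_norm_le_const (Eventually.of_forall fun y =>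
      norm_integral_interaction_le hDb hμb s z y)).trans (mul_le_of_le_one_right hb (hν1 x))
  · simp [meanField, hs]

theorem abs_meanField_sub_le (hD : LipschitzWith 1 D) (hDb : ∀ u, |D u| ≤ 1) (hC : 0 < C)
    (hν1 : ∀ x, (ν x).real univ ≤ 1) (hμb : ∀ x, (μ x).real univ ≤ b)
    (hΞ : Measurable Ξ) (hΞ' : Measurable Ξ') {s δ : ℝ} (hδ : 0 ≤ δ)
    (h : ∀ v y, |Ξ (s, v, y) - Ξ' (s, v, y)| ≤ δ) (x : Ω) (z z' : Torus) :
    |meanField ν μ C D T Ξ x s z - meanField ν μ C D T Ξ' x s z'|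
      ≤ (Icc 0 T).indicator (fun _ => C * b) s * (δ + dist z z') := by
  by_cases hs : s ∈ Icc 0 T
  · simp only [meanField, indicator_of_mem hs]
    have hb : 0 ≤ b := measureReal_nonneg.trans (hμb x)
    have hi : ∀ (Ξ : ℝ × Torus × Ω → ℝ), Measurable Ξ → ∀ z y,
        Integrable (fun v => D (v + (Ξ (s, v, y) : Torus) - z)) (μ y) := fun Ξ hΞ z y =>
      Integrable.of_bound ((measurable_interaction hD hΞ).comp
        (f := fun v : Torus => ((s, z, y), v)) (by fun_prop)).aestronglyMeasurable 1
        (Eventually.of_forall fun _ => hDb _)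
    have hδz : 0 ≤ δ + dist z z' := add_nonneg hδ dist_nonneg
    rw [← mul_sub, abs_mul, abs_of_pos hC, mul_assoc, ← MeasureTheory.integral_sub
      (integrable_integral_interaction hD hDb hμb hΞ s z x)
      (integrable_integral_interaction hD hDb hμb hΞ' s z' x)]
    refine mul_le_mul_of_nonneg_left ?_ hC.le
    have hy : ∀ y, ‖(∫ v, D (v + (Ξ (s, v, y) : Torus) - z) ∂(μ y))
        - ∫ v, D (v + (Ξ' (s, v, y) : Torus) - z') ∂(μ y)‖ ≤ b * (δ + dist z z') := by
      intro y
      rw [← MeasureTheory.integral_sub (hi Ξ hΞ z y) (hi Ξ' hΞ' z' y)]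
      refine (norm_integral_le_of_norm_le_const (C := δ + dist z z')
        (Eventually.of_forall fun v => ?_)).trans ?_
      · refine (interaction_sub_le hD _ _).trans ((dist_sub_sub_le _ _ _ _).trans ?_)
        gcongr
        exact (dist_add_coe_le _ _ _).trans (h v y)
      · rw [mul_comm]
        exact mul_le_mul_of_nonneg_right (hμb y) hδz
    exact (norm_integral_le_of_norm_le_const (Eventually.of_forall hy)).trans
      (mul_le_of_le_one_right (mul_nonneg hb hδz) (hν1 x))
  · simp [meanField, hs]

theorem integrable_indicator_Icc_const (T c : ℝ) :
    Integrable ((Icc 0 T).indicator fun _ : ℝ => c) := by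
  rw [integrable_indicator_iff measurableSet_Icc]
  exact continuous_const.integrableOn_Icc

theorem isLipField_meanField (hD : LipschitzWith 1 D) (hDb : ∀ u, |D u| ≤ 1) (hC : 0 < C)
    (hν1 : ∀ x, (ν x).real univ ≤ 1) (hμb : ∀ x, (μ x).real univ ≤ b) (hΞ : Measurable Ξ) (x : Ω) :
    IsLipField (meanField ν μ C D T Ξ x) ((Icc 0 T).indicator fun _ => C * b) where
  measurable := (measurable_meanField hD hΞ).comp
    (g := fun p : ℝ × Torus × Ω => meanField ν μ C D T Ξ p.2.2 p.1 p.2.1)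
    (f := fun q : ℝ × Torus => (q.1, q.2, x)) (by fun_prop)
  integrable := integrable_indicator_Icc_const T _
  bound := abs_meanField_le hDb hC hν1 hμb x
  lipschitz s z z' := by
    have := abs_meanField_sub_le (T := T) hD hDb hC hν1 hμb hΞ hΞ (s := s) le_rfl
      (fun v y => by simp) x z z'
    rwa [zero_add] at this

/-- The mean-field characteristic system has a global solution, depending measurably on all
variables. -/
theorem exists_isFlow_meanField (hD : LipschitzWith 1 D) (hDb : ∀ u, |D u| ≤ 1) (hC : 0 < C)
    (hν1 : ∀ x, (ν x).real univ ≤ 1) (hμb : ∀ x, (μ x).real univ ≤ b) (hb : 0 ≤ b) (T : ℝ) :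
    ∃ Ξ : ℝ × Torus × Ω → ℝ, Measurable Ξ ∧
      ∀ x, IsFlow (meanField ν μ C D T Ξ x) (fun t u => Ξ (t, u, x)) := by
  set L : ℝ → ℝ := (Icc 0 T).indicator fun _ => 2 * (C * b) with hL
  have hCb : 0 ≤ C * b := mul_nonneg hC.le hb
  have hL0 : ∀ s, 0 ≤ L s := fun s => indicator_nonneg (fun _ _ => by positivity) s
  have hLi : Integrable L := integrable_indicator_Icc_const T _
  have hL2 : ∀ s, (Icc 0 T).indicator (fun _ => C * b) s * 2 = L s := fun s => by
    by_cases hs : s ∈ Icc 0 T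
    · simp only [hL, indicator_of_mem hs]; ring
    · simp [hL, hs]
  set 𝒯 : (ℝ × Torus × Ω → ℝ) → ℝ × Torus × Ω → ℝ := fun Ξ p =>
    ∫ s in (0 : ℝ)..max p.1 0, meanField ν μ C D T Ξ p.2.2 s (p.2.1 + (Ξ (s, p.2) : Torus)) with h𝒯
  have hGm : ∀ Ξ : ℝ × Torus × Ω → ℝ, Measurable Ξ → Measurable (fun q : ℝ × Torus × Ω =>
      meanField ν μ C D T Ξ q.2.2 q.1 (q.2.1 + (Ξ q : Torus))) := fun Ξ hΞ =>
    (measurable_meanField hD hΞ).comp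
      (g := fun p : ℝ × Torus × Ω => meanField ν μ C D T Ξ p.2.2 p.1 p.2.1)
      (f := fun q : ℝ × Torus × Ω => (q.1, q.2.1 + (Ξ q : Torus), q.2.2))
      (measurable_fst.prodMk (((measurable_fst.comp measurable_snd).add
        (AddCircle.measurable_mk'.comp hΞ)).prodMk (measurable_snd.comp measurable_snd)))
  have hint : ∀ Ξ : ℝ × Torus × Ω → ℝ, Measurable Ξ → ∀ (u : Torus) (x : Ω) (a c : ℝ),
      IntervalIntegrable (fun s => meanField ν μ C D T Ξ x s (u + (Ξ (s, u, x) : Torus)))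
        volume a c := fun Ξ hΞ u x a c =>
    (isLipField_meanField hD hDb hC hν1 hμb hΞ x).intervalIntegrable_position
      (ξ := fun s u => Ξ (s, u, x)) (hΞ.comp (f := fun q : ℝ × Torus => (q.1, q.2, x))
        (by fun_prop)) u a c
  obtain ⟨Ξ, hΞm, hΞ⟩ := exists_measurable_fixedPoint
    (fun p : ℝ × Torus × Ω => expWeight L p.1) 𝒯
    (fun Ξ hΞ => measurable_integral_zero_max (hGm Ξ hΞ))
    (fun Ξ Ξ' hΞ hΞ' K hK h p => by
      obtain ⟨t, u, x⟩ := p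
      simp only [h𝒯]
      rw [← intervalIntegral.integral_sub (hint Ξ hΞ u x _ _) (hint Ξ' hΞ' u x _ _)]
      refine abs_integral_le_half_expWeight hLi hK (Eventually.of_forall fun s _ => ?_)
      have hw : 0 ≤ K * expWeight L s := mul_nonneg hK (expWeight_pos L s).le
      refine (abs_meanField_sub_le hD hDb hC hν1 hμb hΞ hΞ' hw (fun v y => h (s, v, y)) x _ _).trans ?_
      have h2 : dist (u + (Ξ (s, u, x) : Torus)) (u + (Ξ' (s, u, x) : Torus))
          ≤ K * expWeight L s := (dist_add_coe_le _ _ _).trans (h (s, u, x))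
      rw [← hL2 s, mul_assoc, two_mul (K * expWeight L s)]
      exact mul_le_mul_of_nonneg_left (add_le_add le_rfl h2)
        (indicator_nonneg (fun _ _ => hCb) s))
    (K := 1) zero_le_one (fun p => by
      refine (abs_integral_le_half_expWeight hLi zero_le_one
        (Eventually.of_forall fun s _ => ?_)).trans
        (mul_le_mul_of_nonneg_right (by norm_num) (expWeight_pos L p.1).le)
      refine (abs_meanField_le hDb hC hν1 hμb _ _ _).trans ?_
      have h1 := one_le_expWeight hL0 s
      have h2 : (Icc 0 T).indicator (fun _ => C * b) s ≤ L s := by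
        rw [← hL2 s]
        linarith [indicator_nonneg (fun _ _ => hCb) s (s := Icc 0 T)]
      nlinarith [hL0 s])
  refine ⟨Ξ, hΞm, fun x => ⟨hΞm.comp (f := fun q : ℝ × Torus => (q.1, q.2, x)) (by fun_prop),
    fun t u => (congrFun hΞ (t, u, x)).symm⟩⟩

/-- The density of the initial measures transported by the flow of the mean field is a weak
solution. -/
theorem exists_isWeakSolution (hD : LipschitzWith 1 D) (hDb : ∀ u, |D u| ≤ 1) (hC : 0 < C)
    (hν1 : ∀ x, (ν x).real univ ≤ 1) (hμb : ∀ x, (μ x).real univ ≤ b) (hb : 0 ≤ b) (hT : 0 < T)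
    {ρ₀ : Torus → Ω → ℝ} (hρ₀ : HasDensity μ ρ₀) :
    ∃ ρ, IsWeakSolution m ν C D T ρ₀ ρ := by
  obtain ⟨Ξ, hΞm, hflow⟩ := exists_isFlow_meanField (ν := ν) (μ := μ) hD hDb hC hν1 hμb hb T
  have hV := fun x => isLipField_meanField (T := T) hD hDb hC hν1 hμb hΞm x
  set V : Ω → ℝ → Torus → ℝ := fun x => meanField ν μ C D T Ξ x
  set ξ : Ω → ℝ → Torus → ℝ := fun x t u => Ξ (t, u, x)
  have hgm : Measurable (Function.uncurry fun (q : ℝ × Ω) (u : Torus) => position (ξ q.2) q.1 u) :=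
    measurable_snd.add (AddCircle.measurable_mk'.comp (hΞm.comp
      (f := fun r : (ℝ × Ω) × Torus => (r.1.1, r.2, r.1.2)) (by fun_prop)))
  obtain ⟨p, hpm, hp0, hp⟩ := exists_measurable_density
    (μ := μ.comap (fun q : ℝ × Ω => q.2) measurable_snd)
    (fun q => by rw [Kernel.comap_apply]; exact hρ₀.absolutelyContinuous q.2) hgm
    (fun q => (hflow q.2).exists_antilipschitz (hV q.2) q.1)
  simp only [Kernel.comap_apply] at hp
  have hpt : ∀ q, Measurable (p q) := fun q => hpm.of_uncurry_left
  have hgt : ∀ t x, Measurable (position (ξ x) t) := fun t x =>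
    (measurable_position (hflow x).measurable).of_uncurry_left
  -- integration against the density is integration along the flow
  have hpf : ∀ t x, ∀ f : Torus → ℝ, Measurable f →
      ∫ u, p (t, x) u * f u = ∫ u, f (position (ξ x) t u) ∂(μ x) := by
    intro t x f hf
    rw [← integral_withDensity_ofReal (hpt _) (Eventually.of_forall (hp0 _)), ← hp (t, x),
      integral_map (hgt t x).aemeasurable hf.aestronglyMeasurable]
  have hpmass : ∀ t x, ∫⁻ u, ENNReal.ofReal (p (t, x) u) = μ x univ := by
    intro t x
    have := congrArg (fun m => m univ) (hp (t, x))
    rw [withDensity_apply _ MeasurableSet.univ, Measure.restrict_univ,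
      Measure.map_apply (hgt t x) MeasurableSet.univ] at this
    exact this.symm
  have hpi : ∀ t x, Integrable (p (t, x)) := fun t x => by
    refine ⟨(hpt _).aestronglyMeasurable, ?_⟩
    rw [hasFiniteIntegral_iff_ofReal (Eventually.of_forall (hp0 _)), hpmass]
    exact measure_lt_top _ _
  have hpI : ∀ t x, ∫ u, ‖p (t, x) u‖ = (μ x).real univ := fun t x => by
    have := hpf t x (fun _ => 1) measurable_const
    simpa [abs_of_nonneg (hp0 (t, x) _)] using this
  -- integrability on the fibers
  have hnode : ∀ t x, Integrable (fun q : Torus × Ω => p (t, q.2) q.1) (volume.prod (ν x)) := by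
    intro t x
    have hm : Measurable (fun q : Torus × Ω => p (t, q.2) q.1) :=
      hpm.comp (f := fun q : Torus × Ω => ((t, q.2), q.1)) (by fun_prop)
    rw [integrable_prod_iff' hm.aestronglyMeasurable]
    refine ⟨Eventually.of_forall fun y => hpi t y, ?_⟩
    simp only [hpI]
    exact Integrable.of_bound
      ((Kernel.measurable_coe μ MeasurableSet.univ).ennreal_toReal).aestronglyMeasurable b
      (Eventually.of_forall fun y => by
        rw [Real.norm_of_nonneg measureReal_nonneg]; exact hμb y)
  have hnodeI : ∀ t x, ∫ q, ‖p (t, q.2) q.1‖ ∂((volume : Measure Torus).prod (ν x)) ≤ b := by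
    intro t x
    rw [integral_prod_symm _ (hnode t x).norm]
    simp only [hpI]
    refine (Real.le_norm_self _).trans ((norm_integral_le_of_norm_le_const (C := b)
      (Eventually.of_forall fun y => ?_)).trans (mul_le_of_le_one_right hb (hν1 x)))
    rw [Real.norm_of_nonneg measureReal_nonneg]; exact hμb y
  -- the characteristic field of the density is the mean field
  have hfield : ∀ (t : Icc (0 : ℝ) T) u x,
      charField ν C D (fun (t : Icc (0 : ℝ) T) u x => p (t, x) u) t u x = V x t u := by
    intro t u x
    have h1 := (integral_integral_mul_interaction hD hDb (S := fun v y => p (t, y) v)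
      (hnode t x) u).2
    simp only [charField, graphopApply, V, meanField, indicator_of_mem t.2]
    rw [h1]
    congr 1
    refine MeasureTheory.integral_congr_ae (Eventually.of_forall fun y => ?_)
    exact hpf t y (fun v => D (v - u)) (hD.continuous.measurable.comp (measurable_id.sub_const u))
  have hρm : Measurable (fun q : Icc (0 : ℝ) T × Torus × Ω => p (q.1, q.2.2) q.2.1) :=
    hpm.comp (f := fun q : Icc (0 : ℝ) T × Torus × Ω => (((q.1 : ℝ), q.2.2), q.2.1)) (by fun_prop)
  refine ⟨fun t u x => p (t, x) u, hρm, Eventually.of_forall fun x t => hpi t x,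
    Eventually.of_forall fun x => ?_, Eventually.of_forall fun x f => ?_,
    Eventually.of_forall fun x w hw => ?_⟩
  · rw [integrable_prod_iff hρm.aestronglyMeasurable]
    refine ⟨Eventually.of_forall fun t => hnode t x, ?_⟩
    refine Integrable.of_bound
      hρm.norm.stronglyMeasurable.integral_prod_right'.aestronglyMeasurable b
      (Eventually.of_forall fun t => ?_)
    rw [Real.norm_of_nonneg (MeasureTheory.integral_nonneg fun _ => norm_nonneg _)]
    exact hnodeI t x
  · have h1 : (fun t : Icc (0 : ℝ) T => ∫ u, p (t, x) u * f u)
        = fun t : Icc (0 : ℝ) T => ∫ u, f (position (ξ x) t u) ∂(μ x) :=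
      funext fun t => hpf t x f f.continuous.measurable
    rw [h1]
    refine continuous_of_dominated (bound := fun _ => ‖f‖) (fun t => ?_) (fun t => ?_)
      (integrable_const _) (Eventually.of_forall fun u => ?_)
    · exact (f.continuous.measurable.comp (hgt t x)).aestronglyMeasurable
    · exact Eventually.of_forall fun u => f.norm_coe_le_norm _
    · exact f.continuous.comp (((hflow x).continuous_position (hV x) u).comp continuous_subtype_val)
  · have hVm : Measurable (Function.uncurry (V x)) := (hV x).measurable
    have h1 : ∀ t : Icc (0 : ℝ) T, ∫ u, p (t, x) u * (deriv (fun s : ℝ => w s u) (t : ℝ)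
        + V x t u * torusDeriv (w (t : ℝ)) u)
        = ∫ u, (deriv (fun s : ℝ => w s (position (ξ x) t u)) (t : ℝ)
          + V x t (position (ξ x) t u) * torusDeriv (w (t : ℝ)) (position (ξ x) t u)) ∂(μ x) := by
      intro t
      refine hpf t x (fun u => deriv (fun s : ℝ => w s u) (t : ℝ)
        + V x t u * torusDeriv (w (t : ℝ)) u) ?_
      refine Measurable.add ?_ (Measurable.mul hVm.of_uncurry_left ?_)
      · exact ((continuous_time_deriv hw.contDiff).comp
          (continuous_const (y := (t : ℝ)) |>.prodMk continuous_id)).measurable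
      · exact ((continuous_space_deriv hw.contDiff).comp
          (continuous_const (y := (t : ℝ)) |>.prodMk continuous_id)).measurable
    simp only [hfield, h1]
    rw [integral_timeMeasure hT]
    have h2 := (hflow x).integral_transport (hV x) (μ x) hw.contDiff hT.le
    obtain ⟨T', hT', hz⟩ := hw.support
    have hwT : ∀ u, w T u = 0 := hz T hT'.le
    simp only [hwT, MeasureTheory.integral_zero, zero_sub] at h2
    have h3 : ∫ u, w 0 u * ρ₀ u x = ∫ u, w 0 u ∂(μ x) := by
      rw [hρ₀.integral_eq]
      simp only [mul_comm]
    rw [h3, ← sub_neg_eq_add, sub_eq_zero, ← h2]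
    refine integral_congr fun s hs => ?_
    rw [uIcc_of_le hT.le] at hs
    simp only [projIcc_of_mem hT.le hs]
    rfl

end Existence

end GraphopVFPE

end

theorem mainTheorem4 {Ω : Type*} [TopologicalSpace Ω] [CompactSpace Ω] [MeasurableSpace Ω]
    [BorelSpace Ω] (m : Measure Ω) [IsProbabilityMeasure m]
    (A : Lp ℝ ∞ m →L[ℝ] Lp ℝ 1 m) (hA : GraphopVFPE.IsGraphop A)
    (ν : Kernel Ω Ω) (hν : GraphopVFPE.IsFiberFamily A ν) (hγ : GraphopVFPE.fiberSup ν ≤ 1)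
    (C : ℝ) (hC : 0 < C)
    (D : GraphopVFPE.Torus → ℝ) (hD : LipschitzWith 1 D) (hDb : ∀ u, |D u| ≤ 1)
    (T : ℝ) (hT : 0 < T) (b : ℝ) (hb : 0 < b)
    (μ₀ : Ω → Measure GraphopVFPE.Torus) (hμ₀ : μ₀ ∈ GraphopVFPE.MBar Ω b)
    (ρ₀ : GraphopVFPE.Torus → Ω → ℝ) (hρ₀ : GraphopVFPE.HasDensity μ₀ ρ₀) :
    ∃ ρ : Set.Icc (0 : ℝ) T → GraphopVFPE.Torus → Ω → ℝ,
      GraphopVFPE.IsWeakSolution m ν C D T ρ₀ ρ ∧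
      ∀ σ : Set.Icc (0 : ℝ) T → GraphopVFPE.Torus → Ω → ℝ,
        GraphopVFPE.IsWeakSolution m ν C D T ρ₀ σ →
          ∀ᵐ x ∂m, ∀ t, ∀ᵐ u : GraphopVFPE.Torus, σ t u x = ρ t u x := by
  have hν1 : ∀ x, ν x Set.univ ≤ 1 := fun x => (le_iSup (fun x => ν x Set.univ) x).trans hγ
  have hμb : ∀ x, μ₀ x Set.univ ≤ ENNReal.ofReal b := fun x =>
    (le_iSup (fun x => μ₀ x Set.univ) x).trans hμ₀.2
  let μ : Kernel Ω GraphopVFPE.Torus := ⟨μ₀, hμ₀.1⟩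
  have hνfin : IsFiniteKernel ν := ⟨1, ENNReal.one_lt_top, hν1⟩
  have hμfin : IsFiniteKernel μ := ⟨ENNReal.ofReal b, ENNReal.ofReal_lt_top, hμb⟩
  have hμ₀fin : ∀ x, IsFiniteMeasure (μ₀ x) := fun x => inferInstanceAs (IsFiniteMeasure (μ x))
  have hν1r : ∀ x, (ν x).real Set.univ ≤ 1 := fun x => ENNReal.toReal_mono ENNReal.one_ne_top (hν1 x)
  have hμbr : ∀ x, (μ₀ x).real Set.univ ≤ b := fun x => ENNReal.toReal_le_of_le_ofReal hb.le (hμb x)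
  obtain ⟨ρ, hρ⟩ := GraphopVFPE.exists_isWeakSolution (m := m) (μ := μ) hD hDb hC hν1r hμbr hb.le
    hT hρ₀
  exact ⟨ρ, hρ, fun σ hσ => hσ.ae_eq hν hν1r hC hD hDb hT hμbr hρ₀ hρ⟩
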